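/- For $n\ge 2$ let $\{Z_t\}_{t\ge 0}$ be the Markov chain on $\{0,1\}^n\setminus\{\mathbf 0\}$ that at each step chooses uniformly at random an ordered pair $(i,j)$ of distinct coordinates and replaces the bit $x(j)$ of the current state $x$ by $x(j)+x(i)$ modulo $2$. Let $H(x)=\sum_{i=1}^n x(i)$ (a sum of integers) be the Hamming weight. Then, for every initial law of $Z_0$, $H_t=H(Z_t)$ is a birth-and-death Markov chain on $\{1,\dots,n\}$, whose transition matrix $P_H$ is given by $$P_H(k,k+1)=\frac{k(n-k)}{n(n-1)},\qquad P_H(k,k-1)=\frac{k(k-1)}{n(n-1)},\qquad P_H(k,k)=\frac{n-k}{n},$$ all other entries being $0$; for every vector $x$ and every $l$, the probability that the walk at $x$ has Hamming weight $l$ after one step is $P_H(H(x),l)$. Its unique stationary law is $\pi_H(k)=\binom nk/(2^n-1)$, $1\le k\le n$. Moreover, this chain exhibits total-variation cutoff at time $\frac32 n\log n$ with window $n$: if $$d_H(t)=\max_{1\le k\le n}\ \max_{A\subseteq\{1,\dots,n\}}\bigl(\pi_H(A)-P_H^t(k,A)\bigr),$$ where $d_H(s)$ at a real time $s$ means $d_H(\max(\lfloor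 s\rfloor,0))$, then $$\lim_{\alpha\to+\infty}\liminf_{n\to\infty}d_H\left(\tfrac32 n\log n-\alpha n\right)=1\quad\text{and}\quad\lim_{\alpha\to+\infty}\limsup_{n\to\infty}d_H\left(\tfrac32 n\log n+\alpha n\right)=0.$$ -/

import Mathlib

open Filter Topology MeasureTheory

namespace HammingWalk

noncomputable section

/-- The non-zero vectors of `{0,1}^n`, with addition modulo 2. -/
abbrev Cube (n : ℕ) : Type := {x : Fin n → ZMod 2 // x ≠ 0}

/-- Replace the bit `x j` by `x j + x i` modulo 2. -/
def addBit {n : ℕ} (i j : Fin n) (x : Fin n → ZMod 2) : Fin n → ZMod 2 :=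
  Function.update x j (x j + x i)

/-- A move along a pair of distinct coordinates keeps the vector non-zero. -/
theorem addBit_ne_zero {n : ℕ} {i j : Fin n} (hij : i ≠ j) {x : Fin n → ZMod 2} (hx : x ≠ 0) :
    addBit i j x ≠ 0 := by
  intro h
  have h' : ∀ k, k ≠ j → x k = 0 := fun k hk => by
    have := congrFun h k
    simpa [addBit, Function.update_of_ne hk] using this
  apply hx
  funext k
  by_cases hk : k = j
  · subst hk
    have := congrFun h k
    simpa [addBit, h' i hij] using this
  · exact h' k hk

/-- Transition matrix of the walk: an ordered pair `(i, j)` of distinct coordinates is chosen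
uniformly at random among the `n (n - 1)` such pairs, and `x j` is replaced by `x j + x i`. -/
def walkP (n : ℕ) : Matrix (Cube n) (Cube n) ℝ := fun x y =>
  ((((Finset.univ : Finset (Fin n)).offDiag.filter
      (fun p => addBit p.1 p.2 x.1 = y.1)).card : ℕ) : ℝ) / ((n : ℝ) * ((n : ℝ) - 1))

/-- The possible Hamming weights `1, ..., n` of a non-zero vector. -/
abbrev Weight (n : ℕ) : Type := {k : ℕ // k ∈ Finset.Icc 1 n}

/-- The Hamming weight of a non-zero vector. -/
def weight {n : ℕ} (x : Cube n) : Weight n :=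
  ⟨hammingNorm x.1, Finset.mem_Icc.mpr
    ⟨hammingNorm_pos_iff.mpr x.2, by simpa using hammingNorm_le_card_fintype (x := x.1)⟩⟩

/-- Probability that the walk at `x` has Hamming weight `l` after one step. -/
def stepToWeight (n : ℕ) (x : Cube n) (l : Weight n) : ℝ :=
  ∑ y : Cube n, if weight y = l then walkP n x y else 0

/-- One-step transition matrix of the Hamming weight: the average over all vectors `x` of weight
`k` (that is, the conditional probability at equilibrium, the equilibrium law being uniform) of the
probability that the walk at `x` has Hamming weight `l` after one step. -/
def weightP (n : ℕ) : Matrix (Weight n) (Weight n) ℝ := fun k l =>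
  (∑ x : Cube n, if weight x = k then stepToWeight n x l else 0) /
    (((Finset.univ.filter (fun x : Cube n => weight x = k)).card : ℕ) : ℝ)

/-- The distribution `k ↦ binom(n, k) / (2 ^ n - 1)` on `1, ..., n`. -/
def weightPi (n : ℕ) (k : Weight n) : ℝ := (n.choose k.1 : ℝ) / (2 ^ n - 1)

/-- `Z` is a (time-homogeneous) Markov chain with transition matrix `P` under `μ`, with an
arbitrary initial law. -/
structure IsMarkovChain {Ω S : Type*} [MeasurableSpace Ω] (μ : Measure Ω) (Z : ℕ → Ω → S)
    (P : Matrix S S ℝ) : Prop where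
  measurable : ∀ (t : ℕ) (s : S), MeasurableSet {ω | Z t ω = s}
  step : ∀ (t : ℕ) (x : ℕ → S),
    μ.real {ω | ∀ s ≤ t + 1, Z s ω = x s} = μ.real {ω | ∀ s ≤ t, Z s ω = x s} * P (x t) (x (t + 1))

/-- `ν` is a probability vector that is stationary for `P`. -/
structure IsStationaryLaw {S : Type*} [Fintype S] (P : Matrix S S ℝ) (ν : S → ℝ) : Prop where
  nonneg : ∀ s, 0 ≤ ν s
  sum_one : ∑ s, ν s = 1
  stationary : ∀ s, ∑ r, ν r * P r s = ν s

/-- Total-variation distance `sup_A (q(A) - p(A))` of two probability vectors. -/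
def tvDist {S : Type*} (p q : S → ℝ) : ℝ :=
  ⨆ A : Finset S, (∑ s ∈ A, q s - ∑ s ∈ A, p s)

/-- Worst-case total-variation distance to equilibrium at time `t` of the Hamming-weight chain. -/
def weightDist (n t : ℕ) : ℝ :=
  ⨆ k : Weight n, tvDist ((weightP n ^ t) k) (weightPi n)

/-- Cutoff at time `t` with window `w`, for a sequence of chains whose `n`-th one is at distance
`d n s` from equilibrium at time `s`. A real time is rounded down (a negative one to 0). -/
def HasCutoff (d : ℕ → ℕ → ℝ) (t w : ℕ → ℝ) : Prop :=
  Tendsto (fun α : ℝ => liminf (fun n : ℕ => d n ⌊t n - α * w n⌋₊) atTop) atTop (𝓝 1) ∧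
  Tendsto (fun α : ℝ => limsup (fun n : ℕ => d n ⌊t n + α * w n⌋₊) atTop) atTop (𝓝 0)

end

end HammingWalk

/-!
The one-step law of the weight depends on the vector only through its weight, which gives the rates
and the Markov property (`IsMarkovChain.lump`); detailed balance with the binomial coefficients and
the vanishing of the stationary flux give the stationary law. The rest concerns the cutoff.

In the fluid limit the proportion `x = k / n` follows the logistic equation `x' = x (1 - 2 x)` in
the time scale `n`, so that `1 / x - 2` decays like `exp (-t / n)`. Starting from a bounded weight,
`1 / k - 2 / n` is of order `1`, and its equilibrium fluctuations are of order `n ^ (-3 / 2)`; it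
takes `3 / 2 n log n` steps to go from one to the other.

*Upper bound.* Gradients evolve by an almost nonnegative operator (`weightOp_succ_sub`), for which
the increments of `1 / (k - 1)`, suitably corrected at both ends, form a supersolution with rate
nearly `1 / n` (`gap_supersolution`). Hence functions which are Lipschitz for the corresponding
distance become constant at that rate (`abs_piAvg_sub_iterate_le`), the states `2, ..., n` having
bounded diameter. An arbitrary function with values in `[0, 1]` becomes Lipschitz with constant of
order `n ^ (3 / 2)` near `n / 2` after `n` steps, since two copies of the chain started at adjacent
weights can be coupled so as to meet by then with probability `1 - O(1 / √n)`
(`abs_iterate_sub_le_pairBound`). Outside this region it is cut off, at a cost controlled by the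
Lipschitz function `|1 / k - 2 / (n + 1)|`. The exceptional state `1` is left after a geometric
time with mean `n` (`weightDist_le`).

*Lower bound.* Starting from the weight `2`, first moment bounds show that after `n log n - β n`
steps the weight is of order `n` but below `n / 8`. From there the mean of `1 / k - 2 / (n + 1)` is
bounded below by an exact drift inequality (`le_weightOp_recip`), and its variance is of order
`n ^ (-3)` (`iterate_recip_sq_le`), so that Chebyshev's inequality separates its law from
equilibrium (`one_sub_le_weightDist`).
-/

namespace HammingWalk

/-! ### Transition rates of the Hamming weight -/

/-- Probability that the weight increases from `k` to `k + 1`. -/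
noncomputable def up (n k : ℕ) : ℝ := (k : ℝ) * ((n : ℝ) - k) / ((n : ℝ) * ((n : ℝ) - 1))

/-- Probability that the weight decreases from `k` to `k - 1`. -/
noncomputable def down (n k : ℕ) : ℝ := (k : ℝ) * ((k : ℝ) - 1) / ((n : ℝ) * ((n : ℝ) - 1))

/-- Transition probability of the weight from `k` to `l`; the three cases are mutually exclusive. -/
noncomputable def rate (n k l : ℕ) : ℝ :=
  (if l = k + 1 then up n k else 0) + (if l + 1 = k then down n k else 0) +
    (if l = k then 1 - (k : ℝ) / n else 0)

theorem hammingNorm_addBit {n : ℕ} {i j : Fin n} (hij : i ≠ j) (x : Fin n → ZMod 2) :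
    hammingNorm (addBit i j x) + (if x i ≠ 0 ∧ x j ≠ 0 then 1 else 0) =
      hammingNorm x + (if x i ≠ 0 ∧ x j = 0 then 1 else 0) := by
  have hsplit : ∀ y : Fin n → ZMod 2, hammingNorm y =
      (∑ k ∈ Finset.univ.erase j, if y k ≠ 0 then 1 else 0) + if y j ≠ 0 then 1 else 0 := by
    intro y
    rw [hammingNorm, Finset.card_filter, Finset.sum_erase_add _ _ (Finset.mem_univ j)]
  have hrest : (∑ k ∈ Finset.univ.erase j, if addBit i j x k ≠ 0 then 1 else 0) =
      ∑ k ∈ Finset.univ.erase j, if x k ≠ 0 then 1 else 0 := by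
    refine Finset.sum_congr rfl fun k hk => ?_
    rw [addBit, Function.update_of_ne (Finset.ne_of_mem_erase hk)]
  have hj : addBit i j x j = x j + x i := by simp [addBit]
  rw [hsplit, hsplit x, hrest, hj]
  have h2 : ∀ a b : ZMod 2, (if a + b ≠ 0 then 1 else 0) + (if b ≠ 0 ∧ a ≠ 0 then 1 else 0) =
      (if a ≠ 0 then 1 else 0) + (if b ≠ 0 ∧ a = 0 then 1 else 0 : ℕ) := by decide
  have := h2 (x j) (x i)
  omega

theorem sum_offDiag_eq {n : ℕ} (F : Fin n → Fin n → ℝ) :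
    ∑ p ∈ (Finset.univ : Finset (Fin n)).offDiag, F p.1 p.2 =
      ∑ i, ∑ j, F i j - ∑ i, F i i := by
  have h := Finset.sum_union (f := fun p : Fin n × Fin n => F p.1 p.2)
    (Finset.disjoint_diag_offDiag (Finset.univ : Finset (Fin n)))
  rw [Finset.diag_union_offDiag, Finset.sum_product, Finset.sum_diag] at h
  linarith

theorem stepToWeight_eq_sum (n : ℕ) (x : Cube n) (l : Weight n) :
    stepToWeight n x l =
      (∑ p ∈ (Finset.univ : Finset (Fin n)).offDiag,
        if hammingNorm (addBit p.1 p.2 x.1) = l.1 then (1 : ℝ) else 0) /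
          ((n : ℝ) * ((n : ℝ) - 1)) := by
  have h1 : ∀ y : Cube n, (if weight y = l then walkP n x y else 0) =
      (∑ p ∈ (Finset.univ : Finset (Fin n)).offDiag,
        if weight y = l ∧ addBit p.1 p.2 x.1 = y.1 then (1 : ℝ) else 0) /
          ((n : ℝ) * ((n : ℝ) - 1)) := by
    intro y
    by_cases hy : weight y = l
    · simp only [hy, if_true, true_and, walkP, Finset.card_filter]
      push_cast
      rfl
    · simp [hy]
  simp_rw [stepToWeight, h1]
  rw [← Finset.sum_div, Finset.sum_comm]
  congr 1
  refine Finset.sum_congr rfl fun p hp => ?_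
  have hne := addBit_ne_zero (Finset.mem_offDiag.1 hp).2.2 x.2
  rw [Finset.sum_eq_single (⟨addBit p.1 p.2 x.1, hne⟩ : Cube n)]
  · simp [weight, Subtype.ext_iff]
  · intro y _ hy
    rw [if_neg]
    rintro ⟨-, h⟩
    exact hy (Subtype.ext h.symm)
  · simp

theorem stepToWeight_eq_rate {n : ℕ} (hn : 2 ≤ n) (x : Cube n) (l : Weight n) :
    stepToWeight n x l = rate n (weight x).1 l.1 := by
  have hn' : (2 : ℝ) ≤ n := by exact_mod_cast hn
  set e : Fin n → ℝ := fun i => if x.1 i ≠ 0 then 1 else 0 with he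
  set k := hammingNorm x.1 with hk
  have hsum : ∑ i, e i = k := by
    rw [hk, hammingNorm, Finset.card_filter]; push_cast; rfl
  have hee : ∀ i, e i * e i = e i := by intro i; by_cases h : x.1 i = 0 <;> simp [he, h]
  have hind : ∀ p ∈ (Finset.univ : Finset (Fin n)).offDiag,
      (if hammingNorm (addBit p.1 p.2 x.1) = l.1 then (1 : ℝ) else 0) =
        (if l.1 = k + 1 then 1 else 0) * (e p.1 * (1 - e p.2)) +
        (if l.1 + 1 = k then 1 else 0) * (e p.1 * e p.2) +
        (if l.1 = k then 1 else 0) * (1 - e p.1) := by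
    intro p hp
    have h := hammingNorm_addBit (Finset.mem_offDiag.1 hp).2.2 x.1
    rw [← hk] at h
    by_cases h1 : x.1 p.1 = 0
    · simp only [h1, ne_eq, not_true_eq_false, false_and, if_false, add_zero] at h
      simp [he, h1, h, eq_comm (a := l.1)]
    · by_cases h2 : x.1 p.2 = 0
      · simp only [h1, h2, ne_eq, not_true_eq_false, not_false_eq_true, and_false, and_true,
          if_false, if_true, add_zero] at h
        simp [he, h1, h2, h, eq_comm (a := l.1)]
      · simp only [h1, h2, ne_eq, not_false_eq_true, and_false, and_true,
          if_false, if_true, add_zero] at h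
        simp [he, h1, h2, ← h, eq_comm (a := l.1)]
  rw [stepToWeight_eq_sum, Finset.sum_congr rfl hind,
    sum_offDiag_eq (fun i j => (if l.1 = k + 1 then 1 else 0) * (e i * (1 - e j)) +
        (if l.1 + 1 = k then 1 else 0) * (e i * e j) + (if l.1 = k then 1 else 0) * (1 - e i))]
  simp only [Finset.sum_add_distrib, ← Finset.mul_sum, mul_sub, mul_one, hee, sub_self,
    Finset.sum_sub_distrib, hsum, Finset.sum_const, Finset.card_univ, Fintype.card_fin,
    nsmul_eq_mul, ← Finset.sum_mul]
  have hw : (weight x).1 = k := rfl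
  rw [rate, hw, up, down]
  have h0 : (n : ℝ) ≠ 0 := by positivity
  have h1 : (n : ℝ) - 1 ≠ 0 := by linarith
  by_cases ha : l.1 = k + 1
  · have hb : ¬ l.1 + 1 = k := by omega
    have hc : ¬ l.1 = k := by omega
    simp only [if_pos ha, if_neg hb, if_neg hc]
    ring
  · by_cases hb : l.1 + 1 = k
    · have hc : ¬ l.1 = k := by omega
      simp only [if_neg ha, if_pos hb, if_neg hc]
      ring
    · by_cases hc : l.1 = k
      · simp only [if_neg ha, if_neg hb, if_pos hc]
        field_simp
        ring
      · simp only [if_neg ha, if_neg hb, if_neg hc]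
        ring

theorem exists_weight_eq {n : ℕ} (k : Weight n) : ∃ x : Cube n, weight x = k := by
  obtain ⟨k, hk⟩ := k
  obtain ⟨h1, hn⟩ := Finset.mem_Icc.1 hk
  let x : Fin n → ZMod 2 := fun i => if i.1 < k then 1 else 0
  have hx : hammingNorm x = k := by
    have : (Finset.univ.filter fun i : Fin n => x i ≠ 0) =
        Finset.univ.filter fun i : Fin n => i.1 < k := by
      ext i; simp [x]
    rw [hammingNorm, this, Fin.card_filter_val_lt]
    simpa using hn
  have hx0 : x ≠ 0 := hammingNorm_pos_iff.1 (by omega)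
  exact ⟨⟨x, hx0⟩, Subtype.ext hx⟩

theorem weightP_eq_rate {n : ℕ} (hn : 2 ≤ n) (k l : Weight n) :
    weightP n k l = rate n k.1 l.1 := by
  obtain ⟨x, hx⟩ := exists_weight_eq k
  have hpos : 0 < (Finset.univ.filter (fun x : Cube n => weight x = k)).card :=
    Finset.card_pos.2 ⟨x, by simp [hx]⟩
  have h : ∀ x : Cube n, (if weight x = k then stepToWeight n x l else 0) =
      if weight x = k then rate n k.1 l.1 else 0 := by
    intro x
    split_ifs with h
    · rw [stepToWeight_eq_rate hn, h]
    · rfl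
  rw [weightP, Finset.sum_congr rfl fun x _ => h x, ← Finset.sum_filter, Finset.sum_const,
    nsmul_eq_mul, mul_div_cancel_left₀ _ (by exact_mod_cast hpos.ne')]

/-! ### The weight of the walk is a Markov chain -/

theorem measureReal_sum_fiber {Ω S : Type*} [MeasurableSpace Ω] [Fintype S] (μ : Measure Ω)
    [IsProbabilityMeasure μ] (Y : Ω → S) (hY : ∀ s, MeasurableSet {ω | Y ω = s}) (A : Set Ω) :
    μ.real A = ∑ s, μ.real (A ∩ {ω | Y ω = s}) := by
  classical
  have hd : Set.PairwiseDisjoint (↑(Finset.univ : Finset S)) fun s => {ω | Y ω = s} := by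
    intro s _ s' _ hs
    rw [Function.onFun, Set.disjoint_left]
    intro ω h h'
    exact hs (h.symm.trans h')
  have := measureReal_biUnion_finset (μ := μ.restrict A) hd (fun s _ => hY s)
    (fun _ _ => measure_ne_top _ _)
  have hu : (⋃ s ∈ (Finset.univ : Finset S), {ω | Y ω = s}) = Set.univ := by ext; simp
  rw [hu] at this
  rw [measureReal_restrict_apply MeasurableSet.univ, Set.univ_inter] at this
  rw [this]
  refine Finset.sum_congr rfl fun s _ => ?_
  rw [measureReal_restrict_apply (hY s), Set.inter_comm]

/-- A function of a Markov chain for which the law of the next value depends on the current state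
only through its value is a Markov chain (lumpability). -/
theorem IsMarkovChain.lump {Ω S R : Type*} [MeasurableSpace Ω] [Fintype S]
    {μ : Measure Ω} [IsProbabilityMeasure μ] {Z : ℕ → Ω → S} {P : Matrix S S ℝ}
    (hZ : IsMarkovChain μ Z P) (w : S → R) (Q : Matrix R R ℝ) [DecidableEq R]
    (hQ : ∀ x l, (∑ y, if w y = l then P x y else 0) = Q (w x) l) :
    IsMarkovChain μ (fun t ω => w (Z t ω)) Q := by
  classical
  refine ⟨fun t r => ?_, fun t r => ?_⟩
  · have : {ω | w (Z t ω) = r} = ⋃ s ∈ {s : S | w s = r}, {ω | Z t ω = s} := by ext; simp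
    rw [this]
    exact MeasurableSet.biUnion (Set.to_countable _) fun s _ => hZ.measurable t s
  · -- decompose the past according to the path `ω ↦ (Z 0 ω, ..., Z t ω)`
    let Y : Ω → (Fin (t + 1) → S) := fun ω i => Z i ω
    have hY : ∀ s, MeasurableSet {ω | Y ω = s} := by
      intro s
      have : {ω | Y ω = s} = ⋂ i : Fin (t + 1), {ω | Z i ω = s i} := by
        ext ω; simp [Y, funext_iff]
      rw [this]
      exact MeasurableSet.iInter fun i => hZ.measurable _ _
    rw [measureReal_sum_fiber μ Y hY, measureReal_sum_fiber μ Y hY {ω | ∀ s ≤ t, w (Z s ω) = r s},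
      Finset.sum_mul]
    refine Finset.sum_congr rfl fun p _ => ?_
    have hp : ∀ ω, Y ω = p ↔ ∀ s (hs : s ≤ t), Z s ω = p ⟨s, by omega⟩ := by
      intro ω
      constructor
      · rintro rfl s hs; rfl
      · intro h
        ext i
        exact h i.1 (by omega)
    by_cases hc : ∀ s (hs : s ≤ t), w (p ⟨s, by omega⟩) = r s
    · have e1 : {ω | ∀ s ≤ t, w (Z s ω) = r s} ∩ {ω | Y ω = p} = {ω | Y ω = p} := by
        apply Set.inter_eq_right.2
        intro ω hω s hs
        rw [(hp ω).1 hω s hs, hc s hs]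
      let path : S → ℕ → S := fun y s => if h : s < t + 1 then p ⟨s, h⟩ else y
      have hpath : ∀ y s (hs : s ≤ t), path y s = p ⟨s, by omega⟩ := fun y s hs => by
        simp only [path]; rw [dif_pos (by omega)]
      have hpath' : ∀ y, path y (t + 1) = y := fun y => by simp [path]
      have e2 : ∀ y, {ω | ∀ s ≤ t, Z s ω = path y s} = {ω | Y ω = p} := by
        intro y; ext ω
        rw [Set.mem_ofPred_eq, Set.mem_ofPred_eq, hp]
        exact forall₂_congr fun s hs => by rw [hpath y s hs]
      rw [e1, measureReal_sum_fiber μ (Z (t + 1)) (hZ.measurable _), ← hc t le_rfl, ← hQ,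
        Finset.mul_sum]
      refine Finset.sum_congr rfl fun y _ => ?_
      split_ifs with hy
      · have h := hZ.step t (path y)
        rw [e2, hpath' y, hpath y t le_rfl] at h
        rw [← h]
        congr 1
        ext ω
        simp only [Set.mem_inter_iff, Set.mem_ofPred_eq]
        rw [hp]
        constructor
        · rintro ⟨⟨-, h2⟩, h3⟩ s hs
          rcases Nat.lt_or_ge t s with h | h
          · obtain rfl : s = t + 1 := by omega
            rw [h3, hpath']
          · rw [h2 s h, hpath y s h]
        · intro h
          have h3 : Z (t + 1) ω = y := by rw [h _ le_rfl, hpath']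
          have h2 : ∀ s (hs : s ≤ t), Z s ω = p ⟨s, by omega⟩ := fun s hs => by
            rw [h s (by omega), hpath y s hs]
          refine ⟨⟨fun s hs => ?_, h2⟩, h3⟩
          rcases Nat.lt_or_ge t s with h | h
          · obtain rfl : s = t + 1 := by omega
            rw [h3, hy]
          · rw [h2 s h, hc s h]
      · rw [mul_zero]
        convert measureReal_empty (μ := μ)
        ext ω
        simp only [Set.mem_inter_iff, Set.mem_ofPred_eq, Set.mem_empty_iff_false, iff_false]
        rintro ⟨⟨h1, -⟩, h3⟩
        exact hy (by rw [← h3]; exact h1 _ le_rfl)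
    · push Not at hc
      obtain ⟨s, hs, hne⟩ := hc
      have e : ∀ T, t ≤ T → {ω | ∀ s ≤ T, w (Z s ω) = r s} ∩ {ω | Y ω = p} = ∅ := by
        intro T hT
        ext ω
        simp only [Set.mem_inter_iff, Set.mem_ofPred_eq, Set.mem_empty_iff_false, iff_false]
        rintro ⟨h1, h2⟩
        exact hne (by rw [← (hp ω).1 h2 s hs]; exact h1 s (by omega))
      rw [e _ (by omega), e _ le_rfl]
      simp

/-! ### The transition operator on functions of the weight -/

/-- The transition operator of the weight chain, acting on functions of an unrestricted natural
number. Since `down n 1 = 0` and `up n n = 0`, its values on `1, ..., n` involve only the values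
of `φ` there. -/
noncomputable def weightOp (n : ℕ) (φ : ℕ → ℝ) (k : ℕ) : ℝ :=
  up n k * φ (k + 1) + down n k * φ (k - 1) + (1 - (k : ℝ) / n) * φ k

theorem up_add_down {n : ℕ} (hn : 2 ≤ n) (k : ℕ) : up n k + down n k = (k : ℝ) / n := by
  have hn' : (2 : ℝ) ≤ n := by exact_mod_cast hn
  have h1 : (n : ℝ) - 1 ≠ 0 := by linarith
  rw [up, down]
  field_simp
  ring

theorem up_nonneg {n k : ℕ} (hn : 2 ≤ n) (hk : k ≤ n) : 0 ≤ up n k := by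
  have hn' : (2 : ℝ) ≤ n := by exact_mod_cast hn
  have hk' : (k : ℝ) ≤ n := by exact_mod_cast hk
  exact div_nonneg (mul_nonneg (by positivity) (by linarith))
    (mul_nonneg (by positivity) (by linarith))

theorem down_nonneg {n : ℕ} (hn : 2 ≤ n) (k : ℕ) : 0 ≤ down n k := by
  have hn' : (2 : ℝ) ≤ n := by exact_mod_cast hn
  rcases Nat.eq_zero_or_pos k with rfl | hk
  · simp [down]
  · have hk' : (1 : ℝ) ≤ k := by exact_mod_cast hk
    exact div_nonneg (mul_nonneg (by positivity) (by linarith))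
      (mul_nonneg (by positivity) (by linarith))

theorem stay_nonneg {n k : ℕ} (hn : 2 ≤ n) (hk : k ≤ n) : 0 ≤ 1 - (k : ℝ) / n := by
  have hn' : (0 : ℝ) < n := by exact_mod_cast (by omega : 0 < n)
  have hk' : (k : ℝ) ≤ n := by exact_mod_cast hk
  rw [sub_nonneg, div_le_one hn']
  exact hk'

@[simp] theorem up_self (n : ℕ) : up n n = 0 := by simp [up]

@[simp] theorem down_one (n : ℕ) : down n 1 = 0 := by simp [down]

theorem weightOp_mono {n : ℕ} (hn : 2 ≤ n) {φ χ : ℕ → ℝ}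
    (h : ∀ k, 1 ≤ k → k ≤ n → φ k ≤ χ k) {k : ℕ} (hk : 1 ≤ k) (hkn : k ≤ n) :
    weightOp n φ k ≤ weightOp n χ k := by
  have h1 : up n k * φ (k + 1) ≤ up n k * χ (k + 1) := by
    rcases hkn.eq_or_lt with rfl | h'
    · simp
    · exact mul_le_mul_of_nonneg_left (h _ (by omega) h') (up_nonneg hn hkn)
  have h2 : down n k * φ (k - 1) ≤ down n k * χ (k - 1) := by
    rcases hk.eq_or_lt with rfl | h'
    · simp
    · exact mul_le_mul_of_nonneg_left (h _ (by omega) (by omega)) (down_nonneg hn k)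
  have h3 := mul_le_mul_of_nonneg_left (h k hk hkn) (stay_nonneg hn hkn)
  rw [weightOp, weightOp]
  linarith

theorem weightOp_lin {n : ℕ} (hn : 2 ≤ n) (a b c : ℝ) (φ χ : ℕ → ℝ) :
    weightOp n (fun k => a * φ k + b * χ k + c) =
      fun k => a * weightOp n φ k + b * weightOp n χ k + c := by
  funext k
  have h := up_add_down hn k
  simp only [weightOp]
  linear_combination c * h

theorem iterate_weightOp_lin {n : ℕ} (hn : 2 ≤ n) (t : ℕ) (a b c : ℝ) (φ χ : ℕ → ℝ) :
    (weightOp n)^[t] (fun k => a * φ k + b * χ k + c) =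
      fun k => a * (weightOp n)^[t] φ k + b * (weightOp n)^[t] χ k + c := by
  induction t generalizing φ χ with
  | zero => rfl
  | succ t ih => simp only [Function.iterate_succ_apply, weightOp_lin hn, ih]

theorem iterate_weightOp_mono {n : ℕ} (hn : 2 ≤ n) (t : ℕ) {φ χ : ℕ → ℝ}
    (h : ∀ k, 1 ≤ k → k ≤ n → φ k ≤ χ k) {k : ℕ} (hk : 1 ≤ k) (hkn : k ≤ n) :
    (weightOp n)^[t] φ k ≤ (weightOp n)^[t] χ k := by
  induction t generalizing φ χ with
  | zero => exact h k hk hkn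
  | succ t ih =>
    simp only [Function.iterate_succ_apply]
    exact ih fun j hj hjn => weightOp_mono hn h hj hjn

theorem iterate_weightOp_const {n : ℕ} (hn : 2 ≤ n) (t : ℕ) (c : ℝ) (k : ℕ) :
    (weightOp n)^[t] (fun _ => c) k = c := by
  have := congrFun (iterate_weightOp_lin hn t 0 0 c (fun _ => 0) (fun _ => 0)) k
  simpa using this

theorem iterate_weightOp_nonneg {n : ℕ} (hn : 2 ≤ n) (t : ℕ) {φ : ℕ → ℝ}
    (h : ∀ k, 1 ≤ k → k ≤ n → 0 ≤ φ k) {k : ℕ} (hk : 1 ≤ k) (hkn : k ≤ n) :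
    0 ≤ (weightOp n)^[t] φ k := by
  have := iterate_weightOp_mono hn t (φ := fun _ => 0) h hk hkn
  rwa [iterate_weightOp_const hn] at this

theorem iterate_weightOp_le {n : ℕ} (hn : 2 ≤ n) (t : ℕ) {φ : ℕ → ℝ} {c : ℝ}
    (h : ∀ k, 1 ≤ k → k ≤ n → φ k ≤ c) {k : ℕ} (hk : 1 ≤ k) (hkn : k ≤ n) :
    (weightOp n)^[t] φ k ≤ c := by
  have := iterate_weightOp_mono hn t (χ := fun _ => c) h hk hkn
  rwa [iterate_weightOp_const hn] at this

/-- A drift inequality iterates to geometric decay down to the level `b / (1 - a)`. -/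
theorem iterate_weightOp_le_of_drift {n : ℕ} (hn : 2 ≤ n) {f : ℕ → ℝ} {a b : ℝ} (ha : 0 ≤ a)
    (ha1 : a < 1) (hb : 0 ≤ b)
    (h : ∀ k, 1 ≤ k → k ≤ n → weightOp n f k ≤ a * f k + b) (t : ℕ) {k : ℕ} (hk : 1 ≤ k)
    (hkn : k ≤ n) :
    (weightOp n)^[t] f k ≤ a ^ t * f k + b / (1 - a) := by
  have h1 : 0 < 1 - a := by linarith
  have hc : a * (b / (1 - a)) + b = b / (1 - a) := by field_simp; ring
  induction t with
  | zero => have := div_nonneg hb h1.le; simpa using this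
  | succ t ih =>
    have h2 := iterate_weightOp_mono hn t h hk hkn
    have h3 := congrFun (iterate_weightOp_lin hn t a 0 b f f) k
    simp only [zero_mul, add_zero] at h3
    rw [Function.iterate_succ_apply]
    rw [h3] at h2
    calc _ ≤ _ := h2
      _ ≤ a * (a ^ t * f k + b / (1 - a)) + b := by gcongr
      _ = _ := by rw [pow_succ]; linear_combination hc

theorem le_iterate_weightOp_of_drift {n : ℕ} (hn : 2 ≤ n) {f : ℕ → ℝ} {a : ℝ} (ha : 0 ≤ a)
    (h : ∀ k, 1 ≤ k → k ≤ n → a * f k ≤ weightOp n f k) (t : ℕ) {k : ℕ} (hk : 1 ≤ k)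
    (hkn : k ≤ n) :
    a ^ t * f k ≤ (weightOp n)^[t] f k := by
  induction t with
  | zero => simp
  | succ t ih =>
    have h2 := iterate_weightOp_mono hn t h hk hkn
    have h3 := congrFun (iterate_weightOp_lin hn t a 0 0 f f) k
    simp only [zero_mul, add_zero] at h3
    rw [Function.iterate_succ_apply]
    rw [h3] at h2
    calc _ = a * (a ^ t * f k) := by rw [pow_succ]; ring
      _ ≤ _ := by gcongr
      _ ≤ _ := h2

theorem sum_rate_mul {n : ℕ} (φ : ℕ → ℝ) {k : ℕ} (hk : 1 ≤ k) (hkn : k ≤ n) :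
    ∑ l : Weight n, rate n k l.1 * φ l.1 = weightOp n φ k := by
  rw [Finset.sum_coe_sort (Finset.Icc 1 n) (fun l => rate n k l * φ l)]
  simp only [rate, add_mul, Finset.sum_add_distrib, ite_mul, zero_mul]
  have e : ∀ l : ℕ, l + 1 = k ↔ l = k - 1 := by omega
  simp only [e, Finset.sum_ite_eq', weightOp]
  rw [if_pos (Finset.mem_Icc.2 ⟨hk, hkn⟩)]
  congr 2
  · split_ifs with h
    · rfl
    · obtain rfl : k = n := by rw [Finset.mem_Icc] at h; omega
      simp
  · split_ifs with h
    · rfl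
    · obtain rfl : k = 1 := by rw [Finset.mem_Icc] at h; omega
      simp

theorem mulVec_weightP {n : ℕ} (hn : 2 ≤ n) (φ : ℕ → ℝ) :
    (weightP n).mulVec (fun l => φ l.1) = fun k => weightOp n φ k.1 := by
  funext k
  obtain ⟨h1, h2⟩ := Finset.mem_Icc.1 k.2
  rw [Matrix.mulVec, dotProduct, ← sum_rate_mul φ h1 h2]
  exact Finset.sum_congr rfl fun l _ => by rw [weightP_eq_rate hn]

theorem mulVec_weightP_pow {n : ℕ} (hn : 2 ≤ n) (t : ℕ) (φ : ℕ → ℝ) :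
    (weightP n ^ t).mulVec (fun l => φ l.1) = fun k => (weightOp n)^[t] φ k.1 := by
  induction t generalizing φ with
  | zero => simp
  | succ t ih => rw [pow_succ, ← Matrix.mulVec_mulVec, mulVec_weightP hn, ih]; rfl

/-- The indicator of a set of weights, as a function on the natural numbers. -/
noncomputable def ind {n : ℕ} (A : Finset (Weight n)) (k : ℕ) : ℝ :=
  if ∃ a ∈ A, a.1 = k then 1 else 0

theorem ind_nonneg {n : ℕ} (A : Finset (Weight n)) (k : ℕ) : 0 ≤ ind A k := by
  rw [ind]; split_ifs <;> norm_num

theorem ind_le_one {n : ℕ} (A : Finset (Weight n)) (k : ℕ) : ind A k ≤ 1 := by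
  rw [ind]; split_ifs <;> norm_num

theorem ind_coe {n : ℕ} (A : Finset (Weight n)) (k : Weight n) :
    ind A k.1 = if k ∈ A then 1 else 0 := by
  simp [ind]

theorem sum_weightP_pow {n : ℕ} (hn : 2 ≤ n) (t : ℕ) (k : Weight n) (A : Finset (Weight n)) :
    ∑ l ∈ A, (weightP n ^ t) k l = (weightOp n)^[t] (ind A) k.1 := by
  rw [← congrFun (mulVec_weightP_pow hn t (ind A)) k, Matrix.mulVec, dotProduct]
  simp_rw [ind_coe, mul_ite, mul_one, mul_zero]
  rw [Finset.sum_ite_mem, Finset.univ_inter]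

/-! ### The stationary law -/

theorem two_pow_sub_one_pos {n : ℕ} (hn : 2 ≤ n) : (0 : ℝ) < 2 ^ n - 1 := by
  have : (1 : ℝ) < 2 ^ n := one_lt_pow₀ (by norm_num) (by omega)
  linarith

theorem weightPi_pos {n : ℕ} (hn : 2 ≤ n) (k : Weight n) : 0 < weightPi n k := by
  have h := Nat.choose_pos (Finset.mem_Icc.1 k.2).2
  exact div_pos (by exact_mod_cast h) (two_pow_sub_one_pos hn)

theorem sum_weightPi {n : ℕ} (hn : 2 ≤ n) : ∑ k : Weight n, weightPi n k = 1 := by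
  have h := Nat.sum_range_choose n
  have h' : ∑ k ∈ Finset.Icc 1 n, (n.choose k : ℝ) = 2 ^ n - 1 := by
    have h2 : ∑ k ∈ Finset.range (n + 1), (n.choose k : ℝ) = 2 ^ n := by exact_mod_cast h
    rw [Finset.sum_range_succ', Nat.choose_zero_right, Nat.cast_one] at h2
    rw [← h2, add_sub_cancel_right, Finset.range_eq_Ico, Finset.sum_Ico_add' (fun k => (n.choose k : ℝ))]
    rfl
  simp only [weightPi]
  rw [← Finset.sum_div, Finset.sum_coe_sort (Finset.Icc 1 n) (fun k => (n.choose k : ℝ)), h',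
    div_self (two_pow_sub_one_pos hn).ne']

theorem choose_mul_up {n : ℕ} {k : ℕ} (hk : k ≤ n) :
    (n.choose k : ℝ) * up n k = n.choose (k + 1) * down n (k + 1) := by
  have h := Nat.choose_succ_right_eq n k
  have h' : (n.choose (k + 1) : ℝ) * (k + 1) = n.choose k * ((n : ℝ) - k) := by
    rw [← Nat.cast_sub hk]; exact_mod_cast h
  rw [up, down]
  push_cast
  rw [mul_div_assoc', mul_div_assoc']
  congr 1
  linear_combination (-(k : ℝ)) * h'

theorem choose_mul_rate {n : ℕ} (k l : Weight n) :
    (n.choose k.1 : ℝ) * rate n k.1 l.1 = n.choose l.1 * rate n l.1 k.1 := by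
  obtain ⟨k, hk⟩ := k
  obtain ⟨l, hl⟩ := l
  rw [Finset.mem_Icc] at hk hl
  simp only [rate]
  rcases lt_trichotomy k l with h | rfl | h
  · by_cases h1 : l = k + 1
    · subst h1
      have h2 : ¬ k + 1 + 1 = k := by omega
      have h3 : ¬ k = k + 1 + 1 := by omega
      simpa [h2, h3] using choose_mul_up (n := n) (k := k) (by omega)
    · rw [if_neg h1, if_neg (by omega), if_neg (by omega), if_neg (by omega), if_neg (by omega),
        if_neg (by omega)]
      simp
  · rfl
  · by_cases h1 : k = l + 1
    · subst h1
      have h2 : ¬ l + 1 + 1 = l := by omega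
      have h3 : ¬ l = l + 1 + 1 := by omega
      simpa [h2, h3] using (choose_mul_up (n := n) (k := l) (by omega)).symm
    · rw [if_neg h1, if_neg (by omega), if_neg (by omega), if_neg (by omega), if_neg (by omega),
        if_neg (by omega)]
      simp

/-- Expectation of a function of the weight under the stationary law. -/
noncomputable def piAvg (n : ℕ) (φ : ℕ → ℝ) : ℝ := ∑ k : Weight n, weightPi n k * φ k.1

theorem isStationaryLaw_weightPi {n : ℕ} (hn : 2 ≤ n) :
    IsStationaryLaw (weightP n) (weightPi n) := by
  refine ⟨fun k => (weightPi_pos hn k).le, sum_weightPi hn, fun s => ?_⟩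
  have h1 : ∀ r, weightPi n r * weightP n r s = weightPi n s * (rate n s.1 r.1 * 1) := by
    intro r
    have h := choose_mul_rate r s
    rw [weightP_eq_rate hn, weightPi, weightPi, div_mul_eq_mul_div, div_mul_eq_mul_div, mul_one, h]
  obtain ⟨hs1, hs2⟩ := Finset.mem_Icc.1 s.2
  rw [Finset.sum_congr rfl fun r _ => h1 r, ← Finset.mul_sum,
    sum_rate_mul (fun _ => 1) hs1 hs2]
  have := iterate_weightOp_const hn 1 1 s.1
  rw [Function.iterate_one] at this
  rw [this, mul_one]

theorem piAvg_weightOp {n : ℕ} (hn : 2 ≤ n) (φ : ℕ → ℝ) :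
    piAvg n (weightOp n φ) = piAvg n φ := by
  have h := (isStationaryLaw_weightPi hn).stationary
  have h1 : ∀ k : Weight n, weightOp n φ k.1 = ∑ l, weightP n k l * φ l.1 := fun k =>
    (congrFun (mulVec_weightP hn φ) k).symm
  simp_rw [piAvg, h1, Finset.mul_sum]
  rw [Finset.sum_comm]
  refine Finset.sum_congr rfl fun l _ => ?_
  rw [← h l, Finset.sum_mul]
  exact Finset.sum_congr rfl fun k _ => by ring

theorem piAvg_iterate {n : ℕ} (hn : 2 ≤ n) (t : ℕ) (φ : ℕ → ℝ) :
    piAvg n ((weightOp n)^[t] φ) = piAvg n φ := by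
  induction t generalizing φ with
  | zero => rfl
  | succ t ih => rw [Function.iterate_succ_apply, ih, piAvg_weightOp hn]

theorem piAvg_mono {n : ℕ} (hn : 2 ≤ n) {φ χ : ℕ → ℝ}
    (h : ∀ k, 1 ≤ k → k ≤ n → φ k ≤ χ k) : piAvg n φ ≤ piAvg n χ := by
  refine Finset.sum_le_sum fun k _ => ?_
  obtain ⟨h1, h2⟩ := Finset.mem_Icc.1 k.2
  exact mul_le_mul_of_nonneg_left (h _ h1 h2) (weightPi_pos hn k).le

theorem piAvg_lin {n : ℕ} (hn : 2 ≤ n) (a b c : ℝ) (φ χ : ℕ → ℝ) :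
    piAvg n (fun k => a * φ k + b * χ k + c) = a * piAvg n φ + b * piAvg n χ + c := by
  have h : ∀ k : Weight n, weightPi n k * (a * φ k.1 + b * χ k.1 + c) =
      a * (weightPi n k * φ k.1) + b * (weightPi n k * χ k.1) + weightPi n k * c :=
    fun k => by ring
  simp only [piAvg, h, Finset.sum_add_distrib, ← Finset.mul_sum, ← Finset.sum_mul,
    sum_weightPi hn, one_mul]

theorem piAvg_le_of_drift {n : ℕ} (hn : 2 ≤ n) {f χ : ℕ → ℝ} {a b c : ℝ}
    (h : ∀ k, 1 ≤ k → k ≤ n → weightOp n f k ≤ a * f k + b * χ k + c) :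
    (1 - a) * piAvg n f ≤ b * piAvg n χ + c := by
  have h1 := piAvg_mono hn h
  rw [piAvg_weightOp hn, piAvg_lin hn] at h1
  linarith

theorem piAvg_ind {n : ℕ} (A : Finset (Weight n)) :
    piAvg n (ind A) = ∑ k ∈ A, weightPi n k := by
  simp_rw [piAvg, ind_coe, mul_ite, mul_one, mul_zero]
  rw [Finset.sum_ite_mem, Finset.univ_inter]

/-- Stationarity of a birth-and-death chain forces the probability flux across each edge to
vanish, which determines the law up to a factor. -/
theorem IsStationaryLaw.eq_weightPi {n : ℕ} (hn : 2 ≤ n) {ν : Weight n → ℝ}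
    (hν : IsStationaryLaw (weightP n) ν) : ν = weightPi n := by
  set v : ℕ → ℝ := fun k => if h : k ∈ Finset.Icc 1 n then ν ⟨k, h⟩ else 0 with hv
  have hvν : ∀ k : Weight n, v k.1 = ν k := fun k => by simp only [hv]; rw [dif_pos k.2]
  have hbal : ∀ s, 1 ≤ s → s ≤ n →
      v (s - 1) * up n (s - 1) + v (s + 1) * down n (s + 1) = v s * ((s : ℝ) / n) := by
    intro s hs hsn
    have h := hν.stationary ⟨s, Finset.mem_Icc.2 ⟨hs, hsn⟩⟩
    simp only [weightP_eq_rate hn, ← hvν] at h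
    rw [Finset.sum_coe_sort (Finset.Icc 1 n) (fun r => v r * rate n r s)] at h
    have e1 : ∀ r : ℕ, s = r + 1 ↔ s - 1 = r := by omega
    simp only [rate, mul_add, Finset.sum_add_distrib, mul_ite, mul_zero, e1,
      Finset.sum_ite_eq] at h
    rw [if_pos (Finset.mem_Icc.2 ⟨hs, hsn⟩)] at h
    have h1 : (if s - 1 ∈ Finset.Icc 1 n then v (s - 1) * up n (s - 1) else 0) =
        v (s - 1) * up n (s - 1) := by
      split_ifs with hc
      · rfl
      · simp only [hv]; rw [dif_neg hc, zero_mul]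
    have h2 : (if s + 1 ∈ Finset.Icc 1 n then v (s + 1) * down n (s + 1) else 0) =
        v (s + 1) * down n (s + 1) := by
      split_ifs with hc
      · rfl
      · simp only [hv]; rw [dif_neg hc, zero_mul]
    rw [h1, h2] at h
    linarith
  have hflux : ∀ s, s ≤ n → v s * up n s = v (s + 1) * down n (s + 1) := by
    intro s
    induction s with
    | zero => intro _; simp [hv, down]
    | succ s ih =>
      intro hs
      have h1 := hbal (s + 1) (by omega) hs
      rw [Nat.add_sub_cancel, ih (by omega), ← up_add_down hn] at h1
      linarith
  have hprop : ∀ k, 1 ≤ k → k ≤ n → v k = v 1 / n * n.choose k := by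
    intro k hk
    induction k, hk using Nat.le_induction with
    | base =>
      intro _
      have : (n : ℝ) ≠ 0 := by exact_mod_cast (by omega : n ≠ 0)
      rw [Nat.choose_one_right]; field_simp
    | succ k hk ih =>
      intro hkn
      have h1 := hflux k (by omega)
      rw [ih (by omega), mul_assoc, choose_mul_up (by omega), ← mul_assoc] at h1
      refine (mul_right_cancel₀ ?_ h1).symm
      have hn' : (2 : ℝ) ≤ n := by exact_mod_cast hn
      have hk' : (1 : ℝ) ≤ k := by exact_mod_cast hk
      rw [down]; push_cast
      have : (0 : ℝ) < ((k : ℝ) + 1) * (k + 1 - 1) / (n * (n - 1)) :=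
        div_pos (by nlinarith) (by nlinarith)
      exact this.ne'
  have hπ : ∀ k, ν k = (v 1 / n * (2 ^ n - 1)) * weightPi n k := by
    intro k
    obtain ⟨h1, h2⟩ := Finset.mem_Icc.1 k.2
    have := (two_pow_sub_one_pos hn).ne'
    rw [← hvν, hprop _ h1 h2, weightPi]
    field_simp
  have hone := hν.sum_one
  simp_rw [hπ] at hone
  rw [← Finset.mul_sum, sum_weightPi hn, mul_one] at hone
  funext k
  rw [hπ, hone, one_mul]

/-! ### Drift inequalities -/

theorem weightOp_eq {n : ℕ} (hn : 2 ≤ n) (φ : ℕ → ℝ) (k : ℕ) :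
    weightOp n φ k = φ k + up n k * (φ (k + 1) - φ k) + down n k * (φ (k - 1) - φ k) := by
  rw [weightOp, ← up_add_down hn]; ring

/-- The reciprocal weight, centred so that its mean decays at rate `(n + 1) / (n (n - 1))`: the
logistic equation `x' = x (1 - 2 x)` is linear in `1 / x - 2`. -/
noncomputable def recip (n k : ℕ) : ℝ := 1 / (k : ℝ) - 2 / ((n : ℝ) + 1)

/-- The relaxation rate `(n + 1) / (n (n - 1))`. -/
noncomputable def relax (n : ℕ) : ℝ := ((n : ℝ) + 1) / ((n : ℝ) * ((n : ℝ) - 1))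

/-- A function comparable to `1 / k ^ 3`. It controls the quadratic variation of `recip`. -/
noncomputable def invCube (k : ℕ) : ℝ := 1 / ((k : ℝ) * ((k : ℝ) + 1) * ((k : ℝ) + 2))

theorem weightOp_natCast_le {n : ℕ} (hn : 2 ≤ n) {k : ℕ} (hk : 1 ≤ k) :
    weightOp n (fun k => (k : ℝ)) k ≤ (1 + 1 / (n : ℝ)) * k := by
  have hn' : (2 : ℝ) ≤ n := by exact_mod_cast hn
  have hk' : (1 : ℝ) ≤ k := by exact_mod_cast hk
  have hN : (0 : ℝ) < (n : ℝ) * ((n : ℝ) - 1) := by nlinarith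
  rw [weightOp_eq hn, up, down]
  push_cast [hk]
  have : (k : ℝ) + k * (n - k) / (n * (n - 1)) * (k + 1 - k) +
      k * (k - 1) / (n * (n - 1)) * (k - 1 - k) =
      (1 + 1 / (n : ℝ)) * k - 2 * k * (k - 1) / (n * (n - 1)) := by
    have : (n : ℝ) - 1 ≠ 0 := by linarith
    field_simp; ring
  rw [this]
  have : 0 ≤ 2 * (k : ℝ) * (k - 1) / (n * (n - 1)) := by
    apply div_nonneg _ hN.le; nlinarith
  linarith

theorem up_mul_recip {n : ℕ} {k : ℕ} (hk : 1 ≤ k) :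
    up n k * (recip n (k + 1) - recip n k) =
      -((n - k) / (k + 1)) / ((n : ℝ) * ((n : ℝ) - 1)) := by
  have hk' : (1 : ℝ) ≤ k := by exact_mod_cast hk
  rw [up, recip, recip]
  push_cast
  have : (1 : ℝ) / (k + 1) - 2 / (n + 1) - (1 / k - 2 / (n + 1)) = -(1 / (k * (k + 1))) := by
    field_simp; ring
  rw [this]
  field_simp

theorem down_mul_recip {n : ℕ} {k : ℕ} (hk : 2 ≤ k) :
    down n k * (recip n (k - 1) - recip n k) = 1 / ((n : ℝ) * ((n : ℝ) - 1)) := by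
  have hk' : (2 : ℝ) ≤ k := by exact_mod_cast hk
  have h1 : (k : ℝ) - 1 ≠ 0 := by linarith
  have h0 : (k : ℝ) ≠ 0 := by linarith
  rw [down, recip, recip]
  push_cast [(by omega : 1 ≤ k)]
  have : (1 : ℝ) / (k - 1) - 2 / (n + 1) - (1 / k - 2 / (n + 1)) = 1 / (k * (k - 1)) := by
    field_simp; ring
  rw [this]
  field_simp

theorem weightOp_recip {n : ℕ} (hn : 2 ≤ n) {k : ℕ} (hk : 2 ≤ k) :
    weightOp n (recip n) k =
      (1 - relax n) * recip n k + relax n / (k * (k + 1)) := by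
  have hk' : (2 : ℝ) ≤ k := by exact_mod_cast hk
  have hn' : (2 : ℝ) ≤ n := by exact_mod_cast hn
  have h1 : (n : ℝ) - 1 ≠ 0 := by linarith
  rw [weightOp_eq hn, up_mul_recip (by omega), down_mul_recip hk, relax, recip]
  field_simp
  ring

theorem weightOp_recip_one {n : ℕ} (hn : 2 ≤ n) :
    weightOp n (recip n) 1 =
      (1 - relax n) * recip n 1 + relax n / 2 - 1 / ((n : ℝ) * ((n : ℝ) - 1)) := by
  have hn' : (2 : ℝ) ≤ n := by exact_mod_cast hn
  have h1 : (n : ℝ) - 1 ≠ 0 := by linarith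
  rw [weightOp_eq hn, up_mul_recip (by omega), down_one, relax, recip]
  push_cast
  field_simp
  ring

theorem relax_pos {n : ℕ} (hn : 2 ≤ n) : 0 < relax n := by
  have hn' : (2 : ℝ) ≤ n := by exact_mod_cast hn
  exact div_pos (by linarith) (by nlinarith)

theorem le_weightOp_recip {n : ℕ} (hn : 2 ≤ n) {k : ℕ} (hk : 1 ≤ k) :
    (1 - relax n) * recip n k ≤ weightOp n (recip n) k := by
  rcases hk.eq_or_lt with rfl | hk
  · rw [weightOp_recip_one hn]
    have hn' : (2 : ℝ) ≤ n := by exact_mod_cast hn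
    have : 1 / ((n : ℝ) * ((n : ℝ) - 1)) ≤ relax n / 2 := by
      rw [relax, div_right_comm]
      gcongr
      · nlinarith
      · linarith
    linarith
  · rw [weightOp_recip hn hk]
    have := relax_pos hn
    have : 0 ≤ relax n / ((k : ℝ) * (k + 1)) := by positivity
    linarith

theorem weightOp_sq {n : ℕ} (hn : 2 ≤ n) (φ : ℕ → ℝ) (k : ℕ) :
    weightOp n (fun j => φ j ^ 2) k = φ k ^ 2 + 2 * φ k * (weightOp n φ k - φ k) +
      (up n k * (φ (k + 1) - φ k) ^ 2 + down n k * (φ (k - 1) - φ k) ^ 2) := by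
  rw [weightOp_eq hn, weightOp_eq hn]; ring

theorem weightOp_recip_sq_le {n : ℕ} (hn : 2 ≤ n) {k : ℕ} (hk : 1 ≤ k) (hkn : k ≤ n) :
    weightOp n (fun j => recip n j ^ 2) k ≤
      (1 - 2 * relax n) * recip n k ^ 2 + 40 / (n : ℝ) * invCube k := by
  have hn' : (2 : ℝ) ≤ n := by exact_mod_cast hn
  have hk' : (1 : ℝ) ≤ k := by exact_mod_cast hk
  have hkn' : (k : ℝ) ≤ n := by exact_mod_cast hkn
  have hN : (0 : ℝ) < (n : ℝ) * ((n : ℝ) - 1) := by nlinarith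
  have hr := relax_pos hn
  have hR : recip n k ≤ 1 / k := by rw [recip]; have : 0 ≤ 2 / ((n : ℝ) + 1) := by positivity
                                    linarith
  have h3 : 0 < invCube k := by rw [invCube]; positivity
  -- the drift term
  have hmain : 2 * recip n k * (weightOp n (recip n) k - recip n k) ≤
      -2 * relax n * recip n k ^ 2 + 18 / n * invCube k := by
    have hT : 2 * recip n k * (relax n / (k * (k + 1))) ≤ 18 / n * invCube k := by
      calc 2 * recip n k * (relax n / (k * (k + 1)))
          ≤ 2 * (1 / k) * (relax n / (k * (k + 1))) := by gcongr
        _ ≤ 18 / n * invCube k := by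
          rw [relax, invCube]
          rw [show 2 * (1 / (k : ℝ)) * ((n + 1) / (n * (n - 1)) / (k * (k + 1))) =
            2 * (n + 1) / (n * (n - 1) * k * (k * (k + 1))) by field_simp,
            show 18 / (n : ℝ) * (1 / (k * (k + 1) * (k + 2))) =
              18 / (n * (k * (k + 1) * (k + 2))) by field_simp,
            div_le_div_iff₀ (by positivity) (by positivity)]
          have h : 2 * ((n : ℝ) + 1) * (k + 2) ≤ 18 * ((n - 1) * k) := by nlinarith
          have h2 : 0 ≤ (n : ℝ) * k * (k + 1) := by positivity
          nlinarith [mul_le_mul_of_nonneg_left h h2]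
    rcases hk.eq_or_lt with rfl | hk2
    · rw [weightOp_recip_one hn]
      have hpos : 0 ≤ recip n 1 := by
        rw [recip, Nat.cast_one, div_one, sub_nonneg, div_le_one (by positivity)]; linarith
      have : 0 ≤ 2 * recip n 1 * (1 / ((n : ℝ) * ((n : ℝ) - 1))) := by positivity
      have e : relax n / (((1 : ℕ) : ℝ) * (((1 : ℕ) : ℝ) + 1)) = relax n / 2 := by norm_num
      rw [e] at hT
      nlinarith
    · rw [weightOp_recip hn hk2]
      nlinarith
  -- the quadratic variation of an upward jump
  have hup : up n k * (recip n (k + 1) - recip n k) ^ 2 ≤ 2 / n * invCube k := by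
    have h : (recip n (k + 1) - recip n k) = -(1 / (k * (k + 1))) := by
      rw [recip, recip]; push_cast; field_simp; ring
    rw [h, up, invCube]
    rw [show (k : ℝ) * (n - k) / (n * (n - 1)) * (-(1 / (k * (k + 1)))) ^ 2 =
      (n - k) / (n * (n - 1) * k * (k + 1) ^ 2) by field_simp,
      show 2 / (n : ℝ) * (1 / (k * (k + 1) * (k + 2))) =
              2 / (n * (k * (k + 1) * (k + 2))) by field_simp,
            div_le_div_iff₀ (by positivity) (by positivity)]
    have h : ((n : ℝ) - k) * (k + 2) ≤ 2 * ((n - 1) * (k + 1)) := by nlinarith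
    have h2 : 0 ≤ (n : ℝ) * k * (k + 1) := by positivity
    nlinarith [mul_le_mul_of_nonneg_left h h2]
  have hdown : down n k * (recip n (k - 1) - recip n k) ^ 2 ≤ 20 / n * invCube k := by
    rcases hk.eq_or_lt with rfl | hk2
    · rw [down_one, zero_mul]; positivity
    have hk2' : (2 : ℝ) ≤ k := by exact_mod_cast hk2
    have h1 : (0 : ℝ) < k - 1 := by linarith
    have h : (recip n (k - 1) - recip n k) = 1 / (k * (k - 1)) := by
      rw [recip, recip]; push_cast [hk]; field_simp; ring
    rw [h, down, invCube]
    rw [show (k : ℝ) * (k - 1) / (n * (n - 1)) * (1 / (k * (k - 1))) ^ 2 =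
      1 / (n * (n - 1) * k * (k - 1)) by field_simp,
      show 20 / (n : ℝ) * (1 / (k * (k + 1) * (k + 2))) =
              20 / (n * (k * (k + 1) * (k + 2))) by field_simp,
            div_le_div_iff₀ (by positivity) (by positivity)]
    have h : ((k : ℝ) + 1) * (k + 2) ≤ 20 * ((n - 1) * (k - 1)) := by nlinarith
    have h2 : 0 ≤ (n : ℝ) * k := by positivity
    nlinarith [mul_le_mul_of_nonneg_left h h2]
  rw [weightOp_sq hn]
  have e : 40 / (n : ℝ) * invCube k = 18 / n * invCube k + 2 / n * invCube k +
    20 / n * invCube k := by ring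
  rw [e]
  linarith

/-- `invCube` decays at a positive rate, down to its equilibrium order `n ^ (-3)`. -/
theorem weightOp_invCube_le {n : ℕ} (hn : 2 ≤ n) {k : ℕ} (hk : 1 ≤ k) :
    weightOp n invCube k ≤ (1 - 1 / (2 * n)) * invCube k + 8000 / (n : ℝ) ^ 4 := by
  have hn' : (2 : ℝ) ≤ n := by exact_mod_cast hn
  have hk' : (1 : ℝ) ≤ k := by exact_mod_cast hk
  have hn1 : (0 : ℝ) < (n : ℝ) - 1 := by linarith
  have hN : (0 : ℝ) < (n : ℝ) * ((n : ℝ) - 1) := by nlinarith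
  have h1 : weightOp n invCube k ≤ invCube k +
      3 * (2 * k + 3 - n) / (n * (n - 1) * ((k + 1) * (k + 2) * (k + 3))) := by
    have hup : up n k * (invCube (k + 1) - invCube k) =
        -3 * (n - k) / (n * (n - 1) * ((k + 1) * (k + 2) * (k + 3))) := by
      rw [up, invCube, invCube]; push_cast; field_simp; ring
    have hdown : down n k * (invCube (k - 1) - invCube k) ≤
        3 * (k + 3) / (n * (n - 1) * ((k + 1) * (k + 2) * (k + 3))) := by
      rcases hk.eq_or_lt with rfl | hk2
      · rw [down_one, zero_mul]; positivity
      have hk2' : (2 : ℝ) ≤ k := by exact_mod_cast hk2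
      have h1 : (0 : ℝ) < k - 1 := by linarith
      apply le_of_eq
      rw [down, invCube, invCube]; push_cast [hk]
      have e : (k : ℝ) - 1 + 2 = k + 1 := by ring
      rw [sub_add_cancel, e]
      field_simp; ring
    rw [weightOp_eq hn, hup]
    have e : 3 * (2 * k + 3 - n) / (n * (n - 1) * ((k + 1) * (k + 2) * (k + 3))) =
      -3 * (n - k) / (n * (n - 1) * ((k + 1) * (k + 2) * (k + 3))) +
      3 * ((k : ℝ) + 3) / (n * (n - 1) * ((k + 1) * (k + 2) * (k + 3))) := by
      rw [← add_div]; congr 1; ring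
    rw [e]; linarith
  refine h1.trans ?_
  have hD : (0 : ℝ) < n * (n - 1) * ((k + 1) * (k + 2) * (k + 3)) := by positivity
  suffices h : 3 * (2 * k + 3 - n) / (n * (n - 1) * ((k + 1) * (k + 2) * (k + 3))) ≤
      - (1 / (2 * n)) * invCube k + 8000 / (n : ℝ) ^ 4 by linarith
  have e2 : 1 / (2 * n) * invCube k ≤
      (2 * (n - 1)) / (n * (n - 1) * ((k + 1) * (k + 2) * (k + 3))) := by
    rw [invCube, show 1 / (2 * (n : ℝ)) * (1 / (k * (k + 1) * (k + 2))) =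
      1 / (2 * n * (k * (k + 1) * (k + 2))) by field_simp,
      div_le_div_iff₀ (by positivity) hD]
    have : 0 ≤ (n : ℝ) * (n - 1) * ((k + 1) * (k + 2)) := by positivity
    nlinarith
  have e3 : (6 * k + 7 - n) / (n * (n - 1) * ((k + 1) * (k + 2) * (k + 3))) ≤
      8000 / (n : ℝ) ^ 4 := by
    rw [div_le_div_iff₀ hD (by positivity)]
    rcases le_or_gt (n : ℝ) (6 * k + 7) with h | h
    · have a1 : (n : ℝ) ≤ 17 * k := by linarith
      have a2 : (n : ℝ) ≤ 2 * (n - 1) := by linarith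
      have b1 : (6 * (k : ℝ) + 7 - n) ≤ 6 * (k + 2) := by linarith
      have b2 : (n : ℝ) ^ 2 ≤ 17 ^ 2 * ((k + 1) * (k + 3)) := by nlinarith
      calc (6 * (k : ℝ) + 7 - n) * (n : ℝ) ^ 4 =
          (6 * (k : ℝ) + 7 - n) * ((n : ℝ) ^ 2 * n * n) := by ring
        _ ≤ 6 * ((k : ℝ) + 2) * (17 ^ 2 * ((k + 1) * (k + 3)) * n * (2 * (n - 1))) := by
          gcongr
        _ = 3468 * ((n : ℝ) * (n - 1) * ((k + 1) * (k + 2) * (k + 3))) := by ring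
        _ ≤ _ := by nlinarith
    · have : (6 * (k : ℝ) + 7 - n) * n ^ 4 ≤ 0 :=
        mul_nonpos_of_nonpos_of_nonneg (by linarith) (by positivity)
      have : 0 ≤ 8000 * ((n : ℝ) * (n - 1) * ((k + 1) * (k + 2) * (k + 3))) := by positivity
      linarith
  have e4 : 3 * (2 * k + 3 - n) / (n * (n - 1) * ((k + 1) * (k + 2) * (k + 3))) =
      (6 * k + 7 - n) / (n * (n - 1) * ((k + 1) * (k + 2) * (k + 3))) -
      (2 * (n - 1 + 0)) / (n * (n - 1) * (((k : ℝ) + 1) * (k + 2) * (k + 3))) := by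
    rw [← sub_div]; congr 1; ring
  rw [e4, add_zero]
  linarith

/-- The second moment of `recip` after `t` steps exceeds the square of the lower bound
`(1 - relax n) ^ t * recip n k` of its mean by at most the accumulated quadratic variation. -/
theorem iterate_recip_sq_le {n : ℕ} (hn : 4 ≤ n) (t : ℕ) {k : ℕ} (hk : 1 ≤ k) (hkn : k ≤ n) :
    (weightOp n)^[t] (fun j => recip n j ^ 2) k ≤
      (1 - 2 * relax n) ^ t * recip n k ^ 2 + 20 * (invCube k + 16000 / (n : ℝ) ^ 3) := by
  have hn2 : 2 ≤ n := by omega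
  have hn' : (4 : ℝ) ≤ n := by exact_mod_cast hn
  have hr := relax_pos hn2
  have hrn : 1 / (n : ℝ) ≤ relax n := by
    rw [relax, div_le_div_iff₀ (by positivity) (by nlinarith)]; nlinarith
  have hr1 : 2 * relax n ≤ 1 := by
    rw [relax, ← mul_div_assoc, div_le_one (by nlinarith)]; nlinarith
  have hf3 : ∀ s, (weightOp n)^[s] invCube k ≤ invCube k + 16000 / (n : ℝ) ^ 3 := by
    intro s
    have hinv : 1 / (2 * (n : ℝ)) ≤ 1 := by rw [div_le_one (by positivity)]; linarith
    have h := iterate_weightOp_le_of_drift hn2 (f := invCube) (a := 1 - 1 / (2 * n))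
      (b := 8000 / (n : ℝ) ^ 4) (by linarith)
      (by have : (0 : ℝ) < 1 / (2 * n) := by positivity
          linarith) (by positivity)
      (fun j hj _ => weightOp_invCube_le hn2 hj) s hk hkn
    have e : 8000 / (n : ℝ) ^ 4 / (1 - (1 - 1 / (2 * n))) = 16000 / (n : ℝ) ^ 3 := by
      rw [sub_sub_cancel]; field_simp; norm_num
    rw [e] at h
    have h3 : 0 ≤ invCube k := by rw [invCube]; positivity
    have : (1 - 1 / (2 * (n : ℝ))) ^ s * invCube k ≤ 1 * invCube k := by
      apply mul_le_mul_of_nonneg_right _ h3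
      exact pow_le_one₀ (by linarith) (by have : (0 : ℝ) < 1 / (2 * n) := by positivity
                                          linarith)
    linarith
  set c := invCube k + 16000 / (n : ℝ) ^ 3 with hc
  have hc0 : 0 ≤ c := by rw [hc, invCube]; positivity
  induction t with
  | zero => simp; positivity
  | succ t ih =>
    have h2 := iterate_weightOp_mono hn2 t
      (χ := fun j => (1 - 2 * relax n) * recip n j ^ 2 + 40 / (n : ℝ) * invCube j + 0)
      (fun j hj hjn => by
        have := weightOp_recip_sq_le hn2 hj hjn
        simpa using this) hk hkn
    have h3 := congrFun (iterate_weightOp_lin hn2 t (1 - 2 * relax n) (40 / (n : ℝ)) 0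
      (fun j => recip n j ^ 2) invCube) k
    rw [Function.iterate_succ_apply]
    rw [h3, add_zero] at h2
    have h4 := hf3 t
    calc _ ≤ _ := h2
      _ ≤ (1 - 2 * relax n) * ((1 - 2 * relax n) ^ t * recip n k ^ 2 + 20 * c) +
          40 * relax n * c := by
        have : 40 / (n : ℝ) * (weightOp n)^[t] invCube k ≤ 40 * relax n * c := by
          calc _ ≤ 40 / (n : ℝ) * c := by gcongr
            _ = 40 * (1 / n) * c := by ring
            _ ≤ _ := by gcongr
        have h5 : 0 ≤ 1 - 2 * relax n := by linarith
        have := mul_le_mul_of_nonneg_left ih h5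
        linarith
      _ = _ := by rw [pow_succ]; ring

theorem piAvg_recip_sq_le {n : ℕ} (hn : 2 ≤ n) :
    piAvg n (fun j => recip n j ^ 2) ≤ 320000 / (n : ℝ) ^ 3 := by
  have hn' : (2 : ℝ) ≤ n := by exact_mod_cast hn
  have hr := relax_pos hn
  have hrn : 1 / (n : ℝ) ≤ relax n := by
    rw [relax, div_le_div_iff₀ (by positivity) (by nlinarith)]; nlinarith
  have h1 := piAvg_le_of_drift hn (f := invCube) (χ := invCube) (a := 1 - 1 / (2 * n)) (b := 0)
    (c := 8000 / (n : ℝ) ^ 4) (fun k hk _ => by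
      have := weightOp_invCube_le hn hk
      simpa using this)
  have h2 := piAvg_le_of_drift hn (f := fun j => recip n j ^ 2) (χ := invCube)
    (a := 1 - 2 * relax n) (b := 40 / n) (c := 0) (fun k hk hkn => by
      have := weightOp_recip_sq_le hn hk hkn
      simpa using this)
  have h3 : piAvg n invCube ≤ 16000 / (n : ℝ) ^ 3 := by
    have : (1 - (1 - 1 / (2 * (n : ℝ)))) * piAvg n invCube = piAvg n invCube / (2 * n) := by ring
    rw [this, zero_mul, zero_add, div_le_iff₀ (by positivity)] at h1
    refine h1.trans (le_of_eq ?_)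
    field_simp; norm_num
  rw [sub_sub_cancel, add_zero] at h2
  have h4 : 2 * relax n * piAvg n (fun j => recip n j ^ 2) ≤
      2 * relax n * (320000 / (n : ℝ) ^ 3) := by
    calc _ ≤ _ := h2
      _ ≤ 40 / n * (16000 / (n : ℝ) ^ 3) := by gcongr
      _ = 2 * (1 / n) * (320000 / (n : ℝ) ^ 3) := by ring
      _ ≤ _ := by gcongr
  exact le_of_mul_le_mul_left h4 (by positivity)

/-! ### Contraction of gradients -/

/-- Weights on the edges `{k, k + 1}`, `1 ≤ k < n`. In the bulk they are the increments of
`1 / (k - 1)`. The large weight at the slow state `1` and the constancy next to `n`, where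
consecutive states nearly swap, make the contraction hold on every edge. -/
noncomputable def gap (n k : ℕ) : ℝ :=
  if k = 1 then √n else if k = n - 1 then 1 / (((n : ℝ) - 2) * ((n : ℝ) - 3))
    else 1 / ((k : ℝ) * ((k : ℝ) - 1))

/-- The contraction rate, `1 / n` up to a relative error of order `1 / √n`. -/
noncomputable def contr (n : ℕ) : ℝ := (1 - 5 / √n) / n

/-- Inequalities on `√n`, with `(n - 1) * (5 / √n)` the slack in the contraction estimates. -/
theorem sqrt_facts {n : ℕ} (hn : 100 ≤ n) : (10 : ℝ) ≤ √n ∧ √(n : ℝ) * √n = n ∧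
    ((n : ℝ) - 1) * (5 / √n) * √n = 5 * (n - 1) ∧ 4 * √(n : ℝ) ≤ ((n : ℝ) - 1) * (5 / √n) ∧
    (n : ℝ) * (n - 1) * contr n = (n - 1) - (n - 1) * (5 / √n) := by
  have hn' : (100 : ℝ) ≤ n := by exact_mod_cast hn
  have h1 : (10 : ℝ) ≤ √n := Real.le_sqrt_of_sq_le (by norm_num; linarith)
  have h2 : √(n : ℝ) * √n = n := Real.mul_self_sqrt (by linarith)
  have h0 : √(n : ℝ) ≠ 0 := by linarith
  refine ⟨h1, h2, by field_simp, ?_, by rw [contr]; field_simp⟩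
  rw [mul_div_assoc', le_div_iff₀ (by linarith)]
  linarith

theorem contr_mem {n : ℕ} (hn : 100 ≤ n) : 0 < contr n ∧ contr n ≤ 1 / n := by
  obtain ⟨h1, -⟩ := sqrt_facts hn
  have hn' : (100 : ℝ) ≤ n := by exact_mod_cast hn
  have h2 : 5 / √(n : ℝ) ≤ 1 / 2 := by rw [div_le_div_iff₀ (by linarith) (by norm_num)]; linarith
  have h3 : 0 < 5 / √(n : ℝ) := div_pos (by norm_num) (by linarith)
  refine ⟨div_pos (by linarith) (by linarith), ?_⟩
  rw [contr]
  gcongr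
  linarith

theorem inv_sq_le_gap {n : ℕ} (hn : 100 ≤ n) {k : ℕ} (hk : 1 ≤ k) (hkn : k < n) :
    1 / (n : ℝ) ^ 2 ≤ gap n k := by
  obtain ⟨h1, -⟩ := sqrt_facts hn
  have hn' : (100 : ℝ) ≤ n := by exact_mod_cast hn
  have hkn' : (k : ℝ) < n := by exact_mod_cast hkn
  rw [gap]
  split_ifs with h h'
  · have : 1 / (n : ℝ) ^ 2 ≤ 1 := by rw [div_le_one (by positivity)]; nlinarith
    linarith
  · rw [div_le_div_iff₀ (by positivity) (by nlinarith)]; nlinarith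
  · have hk' : (2 : ℝ) ≤ k := by exact_mod_cast (by omega : 2 ≤ k)
    rw [div_le_div_iff₀ (by positivity) (by nlinarith)]; nlinarith

theorem gap_pos {n : ℕ} (hn : 100 ≤ n) {k : ℕ} (hk : 1 ≤ k) (hkn : k < n) : 0 < gap n k := by
  have hn' : (100 : ℝ) ≤ n := by exact_mod_cast hn
  exact lt_of_lt_of_le (by positivity) (inv_sq_le_gap hn hk hkn)

theorem abs_recip_sub_le_gap {n : ℕ} (hn : 100 ≤ n) {k : ℕ} (hk : 1 ≤ k) (hkn : k < n) :
    |recip n (k + 1) - recip n k| ≤ gap n k := by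
  obtain ⟨h1, -⟩ := sqrt_facts hn
  have hn' : (100 : ℝ) ≤ n := by exact_mod_cast hn
  have hk0 : (1 : ℝ) ≤ k := by exact_mod_cast hk
  have h : recip n (k + 1) - recip n k = -(1 / (k * (k + 1))) := by
    rw [recip, recip]; push_cast; field_simp; ring
  rw [h, abs_neg, abs_of_nonneg (by positivity), gap]
  split_ifs with h h'
  · subst h; norm_num; linarith
  · have : (k : ℝ) = n - 1 := by rw [h']; push_cast [(by omega : 1 ≤ n)]; ring
    rw [this, div_le_div_iff₀ (by nlinarith) (by nlinarith)]; nlinarith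
  · have hk' : (2 : ℝ) ≤ k := by exact_mod_cast (by omega : 2 ≤ k)
    rw [div_le_div_iff₀ (by positivity) (by nlinarith)]; nlinarith

/-- `gap` is a strict supersolution for the operator that transports gradients. -/
theorem gap_supersolution {n : ℕ} (hn : 100 ≤ n) {k : ℕ} (hk : 1 ≤ k) (hkn : k < n) :
    up n (k + 1) * gap n (k + 1) + |1 - up n k - down n (k + 1)| * gap n k +
      down n k * gap n (k - 1) ≤ (1 - contr n) * gap n k := by
  obtain ⟨hS, hSS, hES, hE, hc⟩ := sqrt_facts hn
  set S := √(n : ℝ) with hSdef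
  set E := ((n : ℝ) - 1) * (5 / S) with hEdef
  have hn' : (100 : ℝ) ≤ n := by exact_mod_cast hn
  have hN : (0 : ℝ) < (n : ℝ) * ((n : ℝ) - 1) := by nlinarith
  have hmid : 1 - up n k - down n (k + 1) =
      (n * (n - 1) - k * (n + 1)) / ((n : ℝ) * ((n : ℝ) - 1)) := by
    rw [up, down]; push_cast
    have h1 : (n : ℝ) - 1 ≠ 0 := by linarith
    field_simp; ring
  rw [hmid, abs_div, abs_of_pos hN]
  suffices h : ((k : ℝ) + 1) * (n - k - 1) * gap n (k + 1) +
      |(n : ℝ) * (n - 1) - k * (n + 1)| * gap n k + k * (k - 1) * gap n (k - 1) ≤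
      ((n : ℝ) * (n - 1) - (n - 1) + E) * gap n k by
    have e : up n (k + 1) * gap n (k + 1) +
        |(n : ℝ) * (n - 1) - k * (n + 1)| / ((n : ℝ) * ((n : ℝ) - 1)) * gap n k +
      down n k * gap n (k - 1) = (((k : ℝ) + 1) * (n - k - 1) * gap n (k + 1) +
      |(n : ℝ) * (n - 1) - k * (n + 1)| * gap n k + k * (k - 1) * gap n (k - 1)) /
        ((n : ℝ) * ((n : ℝ) - 1)) := by
      rw [up, down]; push_cast; ring
    rw [e, div_le_iff₀ hN]
    refine h.trans (le_of_eq ?_)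
    linear_combination (gap n k) * hc
  have hk0 : (1 : ℝ) ≤ k := by exact_mod_cast hk
  rcases (by omega : k = n - 1 ∨ k ≤ n - 2) with rfl | hk2
  -- on the last edge the middle coefficient is `-1 / n`
  · have hK : ((n - 1 : ℕ) : ℝ) = n - 1 := by push_cast [(by omega : 1 ≤ n)]; ring
    have g1 : gap n (n - 1) = 1 / (((n : ℝ) - 2) * ((n : ℝ) - 3)) := by
      rw [gap, if_neg (by omega), if_pos rfl]
    have g2 : gap n (n - 1 - 1) = 1 / (((n : ℝ) - 2) * ((n : ℝ) - 3)) := by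
      rw [gap, if_neg (by omega), if_neg (by omega)]
      have : ((n - 1 - 1 : ℕ) : ℝ) = n - 2 := by
        rw [Nat.sub_sub]; push_cast [(by omega : 2 ≤ n)]; ring
      rw [this]; ring
    rw [hK, g1, g2]
    have habs : |(n : ℝ) * (n - 1) - (n - 1) * (n + 1)| = n - 1 := by
      rw [abs_of_nonpos (by nlinarith)]; ring
    rw [habs]
    have hg : 0 < 1 / (((n : ℝ) - 2) * ((n : ℝ) - 3)) :=
      div_pos one_pos (by nlinarith)
    set g := 1 / (((n : ℝ) - 2) * ((n : ℝ) - 3))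
    nlinarith
  have hk2' : (k : ℝ) ≤ n - 2 := by
    have : (k : ℝ) ≤ ((n - 2 : ℕ) : ℝ) := by exact_mod_cast hk2
    rwa [Nat.cast_sub (by omega)] at this
  have habs : |(n : ℝ) * (n - 1) - k * (n + 1)| = (n : ℝ) * (n - 1) - k * (n + 1) :=
    abs_of_nonneg (by nlinarith)
  rw [habs]
  have gmid : ∀ j : ℕ, 2 ≤ j → j ≤ n - 2 → gap n j = 1 / ((j : ℝ) * ((j : ℝ) - 1)) :=
    fun j h1 h2 => by rw [gap, if_neg (by omega), if_neg (by omega)]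
  have gone : gap n 1 = S := by rw [gap, if_pos rfl]
  rcases (by omega : k = 1 ∨ k = 2 ∨ 3 ≤ k) with rfl | rfl | hk3
  · rw [gone, gmid (1 + 1) (by omega) (by omega)]
    push_cast
    nlinarith
  · rw [gmid (2 + 1) (by omega) (by omega), gmid 2 (by omega) (by omega),
      show (2 - 1 : ℕ) = 1 from rfl, gone]
    push_cast
    norm_num
    linarith
  have hk3' : (3 : ℝ) ≤ k := by exact_mod_cast hk3
  rcases (by omega : k = n - 2 ∨ k ≤ n - 3) with rfl | hk4
  · have g1 : gap n (n - 2 + 1) = 1 / (((n : ℝ) - 2) * ((n : ℝ) - 3)) := by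
      rw [gap, if_neg (by omega), if_pos (by omega)]
    rw [g1, gmid _ (by omega) (by omega), gmid (n - 2 - 1) (by omega) (by omega)]
    have hK : ((n - 2 : ℕ) : ℝ) = n - 2 := by push_cast [(by omega : 2 ≤ n)]; ring
    have hK' : ((n - 2 - 1 : ℕ) : ℝ) = n - 3 := by
      rw [Nat.sub_sub]; push_cast [(by omega : 3 ≤ n)]; ring
    rw [hK, hK']
    have e1 : (n : ℝ) - 2 - 1 = n - 3 := by ring
    have e2 : (n : ℝ) - 3 - 1 = n - 4 := by ring
    rw [e1, e2]
    have p2 : (0 : ℝ) < n - 2 := by linarith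
    have p3 : (0 : ℝ) < n - 3 := by linarith
    have p4 : (0 : ℝ) < n - 4 := by linarith
    have hfrac : ((n : ℝ) - 2) * (n - 3) * (1 / ((n - 3) * (n - 4))) ≤
        ((n : ℝ) ^ 2 - 3 * n + 8) * (1 / ((n - 2) * (n - 3))) := by
      rw [mul_one_div, mul_one_div, div_le_div_iff₀ (by positivity) (by positivity)]
      have h1 : ((n : ℝ) - 2) ^ 2 * (n - 3) ≤ ((n : ℝ) ^ 2 - 3 * n + 8) * (n - 4) := by linarith
      linarith [mul_le_mul_of_nonneg_left h1 p3.le]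
    have hg : 0 < 1 / (((n : ℝ) - 2) * ((n : ℝ) - 3)) := by positivity
    set g := 1 / (((n : ℝ) - 2) * ((n : ℝ) - 3))
    have key : (n : ℝ) - 1 + ((n : ℝ) * (n - 1) - (n - 2) * (n + 1)) +
        ((n : ℝ) ^ 2 - 3 * n + 8) ≤ (n : ℝ) * (n - 1) - (n - 1) + E := by linarith
    have := mul_le_mul_of_nonneg_right key hg.le
    linarith
  · rw [gmid (k + 1) (by omega) (by omega), gmid k (by omega) (by omega),
      gmid (k - 1) (by omega) (by omega)]
    push_cast [(by omega : 1 ≤ k)]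
    have p1 : (0 : ℝ) < k - 1 := by linarith
    have p2 : (0 : ℝ) < k - 2 := by linarith
    have p0 : (0 : ℝ) < k := by linarith
    have e1 : (k : ℝ) - 1 - 1 = k - 2 := by ring
    have hg : 0 < 1 / ((k : ℝ) * (k - 1)) := by positivity
    have t1 : ((k : ℝ) + 1) * (n - k - 1) * (1 / ((k + 1) * (k + 1 - 1))) =
        ((n - k - 1) * (k - 1)) * (1 / ((k : ℝ) * (k - 1))) := by
      rw [add_sub_cancel_right]; field_simp
    have t2 : (k : ℝ) * (k - 1) * (1 / ((k - 1) * (k - 1 - 1))) ≤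
        ((k : ℝ) ^ 2 + k + 6) * (1 / ((k : ℝ) * (k - 1))) := by
      rw [e1, mul_one_div, mul_one_div, div_le_div_iff₀ (by positivity) (by positivity)]
      have h1 : (k : ℝ) ^ 2 * (k - 1) ≤ ((k : ℝ) ^ 2 + k + 6) * (k - 2) := by linarith
      linarith [mul_le_mul_of_nonneg_left h1 p1.le]
    rw [t1]
    set g := 1 / ((k : ℝ) * (k - 1))
    have key : ((n : ℝ) - k - 1) * (k - 1) + ((n : ℝ) * (n - 1) - k * (n + 1)) +
        ((k : ℝ) ^ 2 + k + 6) ≤ (n : ℝ) * (n - 1) - (n - 1) + E := by linarith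
    have := mul_le_mul_of_nonneg_right key hg.le
    linarith

/-- The gradient of `weightOp n ψ` is a combination of neighbouring gradients of `ψ`. All
coefficients are nonnegative, except the middle one on the edge `{n - 1, n}`. -/
theorem weightOp_succ_sub {n : ℕ} (hn : 2 ≤ n) (ψ : ℕ → ℝ) {k : ℕ} (hk : 1 ≤ k) :
    weightOp n ψ (k + 1) - weightOp n ψ k =
      up n (k + 1) * (ψ (k + 1 + 1) - ψ (k + 1)) +
        (1 - up n k - down n (k + 1)) * (ψ (k + 1) - ψ k) +
        down n k * (ψ (k - 1 + 1) - ψ (k - 1)) := by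
  rw [weightOp_eq hn, weightOp_eq hn, Nat.sub_add_cancel hk, Nat.add_sub_cancel]
  ring

theorem abs_weightOp_succ_sub_le {n : ℕ} (hn : 100 ≤ n) {ψ : ℕ → ℝ} {Λ : ℝ} (hΛ : 0 ≤ Λ)
    (h : ∀ k, 1 ≤ k → k < n → |ψ (k + 1) - ψ k| ≤ Λ * gap n k) {k : ℕ} (hk : 1 ≤ k)
    (hkn : k < n) :
    |weightOp n ψ (k + 1) - weightOp n ψ k| ≤ (1 - contr n) * Λ * gap n k := by
  rw [weightOp_succ_sub (by omega) ψ hk]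
  have h1 : |up n (k + 1) * (ψ (k + 1 + 1) - ψ (k + 1))| ≤
      up n (k + 1) * (Λ * gap n (k + 1)) := by
    rcases (by omega : k + 1 = n ∨ k + 1 < n) with h' | h'
    · rw [h']; simp
    · rw [abs_mul, abs_of_nonneg (up_nonneg (by omega) (by omega))]
      exact mul_le_mul_of_nonneg_left (h _ (by omega) h') (up_nonneg (by omega) (by omega))
  have h2 : |(1 - up n k - down n (k + 1)) * (ψ (k + 1) - ψ k)| ≤
      |1 - up n k - down n (k + 1)| * (Λ * gap n k) := by
    rw [abs_mul]; exact mul_le_mul_of_nonneg_left (h k hk hkn) (abs_nonneg _)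
  have h3 : |down n k * (ψ (k - 1 + 1) - ψ (k - 1))| ≤ down n k * (Λ * gap n (k - 1)) := by
    rcases hk.eq_or_lt with rfl | h'
    · simp
    · rw [abs_mul, abs_of_nonneg (down_nonneg (by omega) k)]
      exact mul_le_mul_of_nonneg_left (h _ (by omega) (by omega)) (down_nonneg (by omega) k)
  have h4 := mul_le_mul_of_nonneg_left (gap_supersolution hn hk hkn) hΛ
  refine (abs_add_three _ _ _).trans ?_
  linarith

theorem abs_iterate_succ_sub_le {n : ℕ} (hn : 100 ≤ n) {ψ : ℕ → ℝ} {Λ : ℝ} (hΛ : 0 ≤ Λ)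
    (h : ∀ k, 1 ≤ k → k < n → |ψ (k + 1) - ψ k| ≤ Λ * gap n k) (t : ℕ) {k : ℕ} (hk : 1 ≤ k)
    (hkn : k < n) :
    |(weightOp n)^[t] ψ (k + 1) - (weightOp n)^[t] ψ k| ≤ (1 - contr n) ^ t * Λ * gap n k := by
  induction t generalizing k with
  | zero => simpa using h k hk hkn
  | succ t ih =>
    obtain ⟨c0, c1⟩ := contr_mem hn
    have hn' : (100 : ℝ) ≤ n := by exact_mod_cast hn
    have c2 : 0 ≤ 1 - contr n := by
      have : 1 / (n : ℝ) ≤ 1 := by rw [div_le_one (by positivity)]; linarith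
      linarith
    rw [Function.iterate_succ_apply']
    have := abs_weightOp_succ_sub_le hn (by positivity) (fun k hk hkn => ih hk hkn) hk hkn
    rwa [← mul_assoc, ← pow_succ'] at this

/-- The states `2, ..., n` have bounded diameter for the distance with edge lengths `gap`. -/
theorem abs_sub_le_of_gap {n : ℕ} (hn : 100 ≤ n) {ψ : ℕ → ℝ} {Λ : ℝ} (hΛ : 0 ≤ Λ)
    (h : ∀ k, 1 ≤ k → k < n → |ψ (k + 1) - ψ k| ≤ Λ * gap n k) {x y : ℕ} (hx : 2 ≤ x)
    (hxn : x ≤ n) (hy : 2 ≤ y) (hyn : y ≤ n) : |ψ x - ψ y| ≤ 4 * Λ := by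
  have hn' : (100 : ℝ) ≤ n := by exact_mod_cast hn
  have key : ∀ z, 2 ≤ z → z ≤ n - 1 → |ψ z - ψ 2| ≤ Λ * (1 - 1 / ((z : ℝ) - 1)) := by
    intro z hz
    induction z, hz using Nat.le_induction with
    | base => intro _; norm_num
    | succ z hz ih =>
      intro hzn
      have h1 := ih (by omega)
      have h2 := h z (by omega) (by omega)
      have hz' : (2 : ℝ) ≤ z := by exact_mod_cast hz
      have h3 : gap n z = 1 / ((z : ℝ) - 1) - 1 / z := by
        have : (z : ℝ) - 1 ≠ 0 := by linarith
        rw [gap, if_neg (by omega), if_neg (by omega)]; field_simp; ring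
      have h4 := abs_sub_le (ψ (z + 1)) (ψ z) (ψ 2)
      rw [h3] at h2
      push_cast
      rw [add_sub_cancel_right]
      linarith
  have key2 : ∀ z, 2 ≤ z → z ≤ n → |ψ z - ψ 2| ≤ 2 * Λ := by
    intro z hz hzn
    have h0 : ∀ z : ℕ, 2 ≤ z → z ≤ n - 1 → |ψ z - ψ 2| ≤ Λ := by
      intro z hz hzn
      have hz' : (2 : ℝ) ≤ z := by exact_mod_cast hz
      have : 0 ≤ 1 / ((z : ℝ) - 1) := div_nonneg zero_le_one (by linarith)
      have := key z hz hzn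
      nlinarith
    rcases (by omega : z ≤ n - 1 ∨ z = n - 1 + 1) with h1 | rfl
    · have := h0 z hz h1; linarith
    · have h1 := h0 (n - 1) (by omega) le_rfl
      have h2 := h (n - 1) (by omega) (by omega)
      have h3 : gap n (n - 1) ≤ 1 := by
        rw [gap, if_neg (by omega), if_pos rfl, div_le_one (by nlinarith)]; nlinarith
      have h4 := abs_sub_le (ψ (n - 1 + 1)) (ψ (n - 1)) (ψ 2)
      nlinarith
  have h1 := key2 x hx hxn
  have h2 := key2 y hy hyn
  have h3 := abs_sub_le (ψ x) (ψ 2) (ψ y)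
  rw [abs_sub_comm (ψ 2)] at h3
  linarith

/-- A function whose increments are those of `1 / (k - 1)` away from `1` and with a large value
at `1`; it controls the probability that the weight stays small. -/
noncomputable def lowPot (n k : ℕ) : ℝ := if k = 1 then √n else 1 / ((k : ℝ) - 1)

theorem weightOp_lowPot_le {n : ℕ} (hn : 100 ≤ n) {k : ℕ} (hk : 1 ≤ k) :
    weightOp n (lowPot n) k ≤
      (1 - contr n) * lowPot n k + 2 / ((n : ℝ) * ((n : ℝ) - 1)) := by
  obtain ⟨hS, hSS, hES, hE, hc⟩ := sqrt_facts hn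
  set S := √(n : ℝ) with hSdef
  set E := ((n : ℝ) - 1) * (5 / S) with hEdef
  have hn' : (100 : ℝ) ≤ n := by exact_mod_cast hn
  have hN : (0 : ℝ) < (n : ℝ) * ((n : ℝ) - 1) := by nlinarith
  rw [weightOp_eq (by omega)]
  suffices h : (k : ℝ) * (n - k) * (lowPot n (k + 1) - lowPot n k) +
      k * (k - 1) * (lowPot n (k - 1) - lowPot n k) ≤ (-(n - 1) + E) * lowPot n k + 2 by
    have e : up n k * (lowPot n (k + 1) - lowPot n k) +
        down n k * (lowPot n (k - 1) - lowPot n k) =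
      ((k : ℝ) * (n - k) * (lowPot n (k + 1) - lowPot n k) +
      k * (k - 1) * (lowPot n (k - 1) - lowPot n k)) / ((n : ℝ) * ((n : ℝ) - 1)) := by
      rw [up, down]; ring
    have e2 : (1 - contr n) * lowPot n k + 2 / ((n : ℝ) * ((n : ℝ) - 1)) =
        lowPot n k + ((-(n - 1) + E) * lowPot n k + 2) / ((n : ℝ) * ((n : ℝ) - 1)) := by
      have e3 : contr n = ((n - 1) - E) / ((n : ℝ) * ((n : ℝ) - 1)) := by
        rw [eq_div_iff hN.ne']; linarith
      rw [e3]; ring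
    rw [add_assoc, e, e2]
    gcongr
  have gone : lowPot n 1 = S := by rw [lowPot, if_pos rfl]
  have gmid : ∀ j : ℕ, 2 ≤ j → lowPot n j = 1 / ((j : ℝ) - 1) :=
    fun j h1 => by rw [lowPot, if_neg (by omega)]
  rcases (by omega : k = 1 ∨ k = 2 ∨ 3 ≤ k) with rfl | rfl | hk3
  · rw [gone, gmid (1 + 1) (by omega)]
    push_cast
    norm_num
    nlinarith
  · rw [gmid (2 + 1) (by omega), gmid 2 (by omega), show (2 - 1 : ℕ) = 1 from rfl, gone]
    push_cast
    norm_num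
    linarith
  · have hk3' : (3 : ℝ) ≤ k := by exact_mod_cast hk3
    rw [gmid (k + 1) (by omega), gmid k (by omega), gmid (k - 1) (by omega)]
    push_cast [hk]
    have p1 : (0 : ℝ) < k - 1 := by linarith
    have p2 : (0 : ℝ) < k - 2 := by linarith
    have e1 : (k : ℝ) - 1 - 1 = k - 2 := by ring
    have hg : 0 < 1 / ((k : ℝ) - 1) := by positivity
    have t1 : (k : ℝ) * (n - k) * (1 / (k + 1 - 1) - 1 / (k - 1)) =
        -(n - k) * (1 / ((k : ℝ) - 1)) := by
      rw [add_sub_cancel_right]; field_simp; ring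
    have t2 : (k : ℝ) * (k - 1) * (1 / (k - 1 - 1) - 1 / (k - 1)) ≤
        (k + 3) * (1 / ((k : ℝ) - 1)) := by
      have : (k : ℝ) * (k - 1) * (1 / (k - 2) - 1 / (k - 1)) = k / (k - 2) := by
        field_simp; ring
      rw [e1, this, mul_one_div, div_le_div_iff₀ p2 p1]
      nlinarith
    have t3 : (2 : ℝ) = 2 * (k - 1) * (1 / (k - 1)) := by field_simp
    rw [t1]
    set g := 1 / ((k : ℝ) - 1)
    nlinarith

/-! ### Smoothing by coupling two nearby copies -/

/-- Bound for `n` times the difference after `r` steps of the expectations of a function with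
values in `[0, 1]`, from the initial weights `X ≤ Y`. The first term is concave in the distance
`Y - X`, so that it decreases on average while the copies differ; the second one is at least `n`
once a copy has left the bulk; the last one counts the remaining time. -/
noncomputable def pairBound (n H r X Y : ℝ) : ℝ :=
  4 * (2 * H * (Y - X) - (Y - X) ^ 2) +
    25 / n * ((n + 1 - 2 * X) ^ 2 + (n + 1 - 2 * Y) ^ 2) + (n - r)

/-- Average of `pairBound` over one step of a coupling with marginals `(u, s, d)` and
`(u', s', d')`: the product coupling, in which a mass `m` is moved from (up, down) and (stay, stay)
to (up, stay) and (stay, down). -/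
theorem sum_coupling_pairBound (n H r X Y u d s u' d' s' m : ℝ) (h : u + d + s = 1)
    (h' : u' + d' + s' = 1) :
    u * u' * pairBound n H r (X + 1) (Y + 1) + (u * s' + m) * pairBound n H r (X + 1) Y +
      (u * d' - m) * pairBound n H r (X + 1) (Y - 1) +
      s * u' * pairBound n H r X (Y + 1) + (s * s' - m) * pairBound n H r X Y +
      (s * d' + m) * pairBound n H r X (Y - 1) +
      d * u' * pairBound n H r (X - 1) (Y + 1) + d * s' * pairBound n H r (X - 1) Y +
      d * d' * pairBound n H r (X - 1) (Y - 1) =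
    pairBound n H r X Y +
      4 * (2 * (H - (Y - X)) * ((u' - d') - (u - d)) -
        ((u + d) + (u' + d') - 2 * (u - d) * (u' - d') - 2 * m)) +
      25 / n * (4 * ((u + d) + (u' + d')) - 4 * ((n + 1 - 2 * X) * (u - d)) -
        4 * ((n + 1 - 2 * Y) * (u' - d'))) := by
  obtain rfl : s = 1 - u - d := by linarith
  obtain rfl : s' = 1 - u' - d' := by linarith
  simp only [pairBound]
  ring

/-- The coupling of `sum_coupling_pairBound` has the right marginals. -/
theorem sum_coupling_sub (f g : ℤ → ℝ) (u d s u' d' s' m : ℝ) (h : u + d + s = 1)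
    (h' : u' + d' + s' = 1) :
    u * u' * (f 1 - g 1) + (u * s' + m) * (f 1 - g 0) +
      (u * d' - m) * (f 1 - g (-1)) +
      s * u' * (f 0 - g 1) + (s * s' - m) * (f 0 - g 0) +
      (s * d' + m) * (f 0 - g (-1)) +
      d * u' * (f (-1) - g 1) + d * s' * (f (-1) - g 0) +
      d * d' * (f (-1) - g (-1)) =
    (u * f 1 + d * f (-1) + s * f 0) - (u' * g 1 + d' * g (-1) + s' * g 0) := by
  obtain rfl : s = 1 - u - d := by linarith
  obtain rfl : s' = 1 - u' - d' := by linarith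
  ring

theorem up_sub_down {n : ℕ} (k : ℕ) :
    up n k - down n k = (k : ℝ) * (n + 1 - 2 * k) / ((n : ℝ) * ((n : ℝ) - 1)) := by
  rw [up, down]; ring

/-- Estimates for the one-step law of the weight in the bulk. -/
theorem bulk_estimates {n : ℕ} (hn : 400 ≤ n) {k : ℕ}
    (ha : |(n : ℝ) + 1 - 2 * k| ≤ (n : ℝ) / 5) :
    (2 : ℝ) / 5 ≤ (k : ℝ) / n ∧ (k : ℝ) / n ≤ 61 / 100 ∧ |up n k - down n k| ≤ 1 / 8 ∧
      up n k ≤ 26 / 100 ∧ down n k ≤ 37 / 100 ∧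
      0 ≤ ((n : ℝ) + 1 - 2 * k) * (up n k - down n k) := by
  have hn' : (400 : ℝ) ≤ n := by exact_mod_cast hn
  have hn0 : (0 : ℝ) < n := by linarith
  have hN : (0 : ℝ) < (n : ℝ) * ((n : ℝ) - 1) := by nlinarith
  have hN2 : 399 / 400 * (n : ℝ) ^ 2 ≤ (n : ℝ) * ((n : ℝ) - 1) := by nlinarith
  obtain ⟨h1, h2⟩ := abs_le.1 ha
  have hk1 : 2 / 5 * (n : ℝ) ≤ k := by linarith
  have hk2 : (k : ℝ) ≤ (241 : ℝ) / 400 * n := by linarith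
  have hk0 : (0 : ℝ) ≤ k := by linarith
  refine ⟨by rw [le_div_iff₀ hn0]; linarith, by rw [div_le_iff₀ hn0]; linarith, ?_, ?_, ?_, ?_⟩
  · rw [up_sub_down, abs_div, abs_mul, abs_of_pos hN, abs_of_nonneg hk0, div_le_iff₀ hN]
    calc (k : ℝ) * |(n : ℝ) + 1 - 2 * k| ≤ ((241 : ℝ) / 400 * n) * (n / 5) := by gcongr
      _ ≤ _ := by nlinarith
  · rw [up, div_le_iff₀ hN]; nlinarith [sq_nonneg ((n : ℝ) - 2 * k)]
  · rw [down, div_le_iff₀ hN]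
    have : (k : ℝ) * (k - 1) ≤ ((241 : ℝ) / 400 * n) * ((241 : ℝ) / 400 * n) := by
      gcongr
      · linarith
      · linarith
    nlinarith
  · rw [up_sub_down, mul_div_assoc', ← mul_assoc, mul_comm _ (k : ℝ), mul_assoc]
    exact div_nonneg (mul_nonneg hk0 (mul_self_nonneg _)) hN.le

/-- While the copies are distinct, near each other and in the bulk, the coupling lowers
`pairBound` by at least `1` on average. -/
theorem coupling_drift {n : ℕ} (hn : 400 ≤ n) {H r : ℝ} {x y : ℕ} (hxy : x < y)
    (hD : (y : ℝ) - x ≤ H) (hax : |(n : ℝ) + 1 - 2 * x| ≤ (n : ℝ) / 5)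
    (hay : |(n : ℝ) + 1 - 2 * y| ≤ (n : ℝ) / 5) {m : ℝ} (hm : m ≤ up n x * down n y) :
    pairBound n H r x y +
      4 * (2 * (H - ((y : ℝ) - x)) * ((up n y - down n y) - (up n x - down n x)) -
        ((up n x + down n x) + (up n y + down n y) -
          2 * (up n x - down n x) * (up n y - down n y) - 2 * m)) +
      25 / n * (4 * ((up n x + down n x) + (up n y + down n y)) -
        4 * (((n : ℝ) + 1 - 2 * x) * (up n x - down n x)) -
        4 * (((n : ℝ) + 1 - 2 * y) * (up n y - down n y))) ≤ pairBound n H (r + 1) x y := by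
  obtain ⟨x1, x2, x3, x4, x5, x6⟩ := bulk_estimates hn hax
  obtain ⟨y1, y2, y3, y4, y5, y6⟩ := bulk_estimates hn hay
  have hn' : (400 : ℝ) ≤ n := by exact_mod_cast hn
  have hN : (0 : ℝ) < (n : ℝ) * ((n : ℝ) - 1) := by nlinarith
  have hxy' : (x : ℝ) < y := by exact_mod_cast hxy
  have hdrift : (up n y - down n y) - (up n x - down n x) ≤ 0 := by
    rw [up_sub_down, up_sub_down, sub_nonpos]
    refine div_le_div_of_nonneg_right ?_ hN.le
    obtain ⟨h1, h2⟩ := abs_le.1 hax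
    obtain ⟨h3, h4⟩ := abs_le.1 hay
    nlinarith
  have t1 : 2 * (H - ((y : ℝ) - x)) * ((up n y - down n y) - (up n x - down n x)) ≤ 0 :=
    mul_nonpos_of_nonneg_of_nonpos (by linarith) hdrift
  have t2 : (up n x - down n x) * (up n y - down n y) ≤ 1 / 64 := by
    calc _ ≤ |(up n x - down n x) * (up n y - down n y)| := le_abs_self _
      _ = |up n x - down n x| * |up n y - down n y| := abs_mul _ _
      _ ≤ 1 / 8 * (1 / 8) := by gcongr
      _ = _ := by norm_num
  have t3 : m ≤ 1 / 10 := by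
    have : up n x * down n y ≤ 26 / 100 * (37 / 100) := by
      gcongr
      exact down_nonneg (by omega) y
    linarith
  have t4 : 25 / (n : ℝ) * (4 * ((up n x + down n x) + (up n y + down n y)) -
        4 * (((n : ℝ) + 1 - 2 * x) * (up n x - down n x)) -
        4 * (((n : ℝ) + 1 - 2 * y) * (up n y - down n y))) ≤ 25 / 400 * 8 := by
    have h1 : 25 / (n : ℝ) ≤ 25 / 400 := by gcongr
    calc _ ≤ 25 / (n : ℝ) * 8 := by
          gcongr
          rw [up_add_down (by omega), up_add_down (by omega)]
          linarith
      _ ≤ _ := by gcongr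
  have t5 := up_add_down (n := n) (by omega) x
  have t6 := up_add_down (n := n) (by omega) y
  simp only [pairBound] at *
  linarith

/-- Since `H` is of order `√n`, for adjacent weights near `n / 2` and `r = n` this is a gradient
bound of order `1 / √n`. -/
theorem abs_iterate_sub_le_pairBound {n : ℕ} (hn : 400 ≤ n) {H : ℕ} (hH : n ≤ H ^ 2)
    {φ : ℕ → ℝ} (h0 : ∀ k, 1 ≤ k → k ≤ n → 0 ≤ φ k) (h1 : ∀ k, 1 ≤ k → k ≤ n → φ k ≤ 1)
    {r : ℕ} (hr : r ≤ n) {x y : ℕ} (hx : 1 ≤ x) (hxy : x ≤ y) (hyn : y ≤ n) (hD : y ≤ x + H) :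
    n * |(weightOp n)^[r] φ x - (weightOp n)^[r] φ y| ≤ pairBound n H r x y := by
  have hn2 : 2 ≤ n := by omega
  have hn' : (400 : ℝ) ≤ n := by exact_mod_cast hn
  have hHr : (n : ℝ) ≤ (H : ℝ) ^ 2 := by exact_mod_cast hH
  have triv : ∀ (r x y : ℕ), 1 ≤ x → x ≤ n → 1 ≤ y → y ≤ n →
      (n : ℝ) * |(weightOp n)^[r] φ x - (weightOp n)^[r] φ y| ≤ n := by
    intro r x y hx hxn hy hyn
    have a1 := iterate_weightOp_nonneg hn2 r h0 hx hxn
    have a2 := iterate_weightOp_nonneg hn2 r h0 hy hyn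
    have a3 := iterate_weightOp_le hn2 r h1 hx hxn
    have a4 := iterate_weightOp_le hn2 r h1 hy hyn
    have : |(weightOp n)^[r] φ x - (weightOp n)^[r] φ y| ≤ 1 := abs_le.2 ⟨by linarith, by linarith⟩
    nlinarith
  have hsq : ∀ a b : ℝ, 0 ≤ 25 / (n : ℝ) * (a ^ 2 + b ^ 2) := fun a b => by positivity
  have hout : ∀ a b : ℝ, (n : ℝ) / 5 < |a| → (n : ℝ) ≤ 25 / n * (a ^ 2 + b ^ 2) := by
    intro a b ha
    have h2 : (n / 5 : ℝ) ^ 2 ≤ a ^ 2 := by rw [← sq_abs a]; gcongr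
    rw [div_mul_eq_mul_div, le_div_iff₀ (by linarith)]
    nlinarith [sq_nonneg b]
  induction r generalizing x y with
  | zero =>
    rcases hxy.eq_or_lt with rfl | hlt
    · have := hsq (n + 1 - 2 * x) (n + 1 - 2 * x)
      simp only [pairBound]
      push_cast
      simp only [sub_self, abs_zero]
      nlinarith
    · have := triv 0 x y hx (by omega) (by omega) hyn
      refine this.trans ?_
      have hlt' : (x : ℝ) ≤ y := by exact_mod_cast hxy
      have hD' : (y : ℝ) ≤ x + H := by exact_mod_cast hD
      have := hsq (n + 1 - 2 * x) (n + 1 - 2 * y)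
      simp only [pairBound]
      push_cast
      nlinarith
  | succ r ih =>
    have hD' : (y : ℝ) ≤ x + H := by exact_mod_cast hD
    have hxy' : (x : ℝ) ≤ y := by exact_mod_cast hxy
    have hr' : (r : ℝ) + 1 ≤ n := by exact_mod_cast hr
    have hA : 0 ≤ 2 * (H : ℝ) * (y - x) - (y - x) ^ 2 := by nlinarith
    rcases hxy.eq_or_lt with rfl | hlt
    · have := hsq (n + 1 - 2 * x) (n + 1 - 2 * x)
      simp only [pairBound]
      push_cast
      simp only [sub_self, abs_zero]
      nlinarith
    have ht := triv (r + 1) x y hx (by omega) (by omega) hyn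
    rcases lt_or_ge ((n : ℝ) / 5) |(n : ℝ) + 1 - 2 * x| with hax | hax
    · have := hout _ ((n : ℝ) + 1 - 2 * y) hax
      simp only [pairBound]
      push_cast
      linarith
    rcases lt_or_ge ((n : ℝ) / 5) |(n : ℝ) + 1 - 2 * y| with hay | hay
    · have := hout _ ((n : ℝ) + 1 - 2 * x) hay
      simp only [pairBound]
      push_cast
      linarith
    rcases (by omega : x + H ≤ y + 1 ∨ y + 2 ≤ x + H) with hfar | hnear
    · -- at distance at least `H - 1` the concave term alone is at least `n`
      have hfar' : (x : ℝ) + H ≤ y + 1 := by exact_mod_cast hfar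
      have := hsq (n + 1 - 2 * x) (n + 1 - 2 * y)
      have h2 : (H : ℝ) ^ 2 - 1 ≤ 2 * (H : ℝ) * (y - x) - (y - x) ^ 2 := by nlinarith
      simp only [pairBound]
      push_cast
      linarith
    obtain ⟨x1, x2, -, x4, -, -⟩ := bulk_estimates hn hax
    obtain ⟨y1, y2, -, y4, y5, -⟩ := bulk_estimates hn hay
    have hx2 : 2 ≤ x := by
      by_contra hlt2
      have : (x : ℝ) ≤ 1 := by exact_mod_cast (by omega : x ≤ 1)
      rw [le_div_iff₀ (by linarith)] at x1
      linarith
    have hyn2 : y + 1 ≤ n := by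
      have : (y : ℝ) + 1 ≤ n := by
        rw [div_le_iff₀ (by linarith)] at y2
        linarith
      exact_mod_cast this
    have hux := up_nonneg hn2 (by omega : x ≤ n)
    have huy := up_nonneg hn2 (by omega : y ≤ n)
    have hdx := down_nonneg hn2 x
    have hdy := down_nonneg hn2 y
    have hsx := stay_nonneg hn2 (by omega : x ≤ n)
    have hsy := stay_nonneg hn2 (by omega : y ≤ n)
    -- for adjacent weights, no mass is left on the event that the two copies swap
    obtain ⟨m, hm0, hmle, hms, hm1⟩ : ∃ m : ℝ, 0 ≤ m ∧ m ≤ up n x * down n y ∧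
        m ≤ (1 - (x : ℝ) / n) * (1 - (y : ℝ) / n) ∧ (y = x + 1 → up n x * down n y - m = 0) := by
      by_cases h : y = x + 1
      · refine ⟨up n x * down n y, by positivity, le_rfl, ?_, fun _ => sub_self _⟩
        calc up n x * down n y ≤ 26 / 100 * (37 / 100) := by gcongr
          _ ≤ 39 / 100 * (39 / 100) := by norm_num
          _ ≤ _ := by gcongr <;> linarith
      · exact ⟨0, le_rfl, by positivity, by positivity, fun h' => absurd h' h⟩
    have key : ∀ σ : ℝ, (σ = 1 ∨ σ = -1) →
        (n : ℝ) * σ * ((weightOp n)^[r + 1] φ x - (weightOp n)^[r + 1] φ y) ≤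
          pairBound n H (r + 1) x y := by
      intro σ hσ
      have hB : ∀ x' y' : ℕ, 1 ≤ x' → x' ≤ y' → y' ≤ n → y' ≤ x' + H →
          (n : ℝ) * σ * ((weightOp n)^[r] φ x' - (weightOp n)^[r] φ y') ≤
            pairBound n H r x' y' := by
        intro x' y' a b c d
        refine le_trans ?_ (ih (by omega) a b c d)
        rw [mul_assoc]
        gcongr
        rcases hσ with rfl | rfl
        · rw [one_mul]; exact le_abs_self _
        · rw [neg_one_mul]; exact neg_le_abs _
      set ψ := (weightOp n)^[r] φ with hψ
      rw [Function.iterate_succ_apply', ← hψ]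
      set f : ℤ → ℝ := fun a => ψ (x + a).toNat with hf
      set g : ℤ → ℝ := fun b => ψ (y + b).toNat with hg
      have f1 : f 1 = ψ (x + 1) := by simp only [hf]; congr 1
      have f0 : f 0 = ψ x := by simp only [hf]; congr 1
      have fm : f (-1) = ψ (x - 1) := by simp only [hf]; congr 1; omega
      have g1 : g 1 = ψ (y + 1) := by simp only [hg]; congr 1
      have g0 : g 0 = ψ y := by simp only [hg]; congr 1
      have gm : g (-1) = ψ (y - 1) := by simp only [hg]; congr 1; omega
      have hX : up n x + down n x + (1 - (x : ℝ) / n) = 1 := by rw [up_add_down hn2]; ring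
      have hY : up n y + down n y + (1 - (y : ℝ) / n) = 1 := by rw [up_add_down hn2]; ring
      have hid := sum_coupling_sub f g _ _ _ _ _ _ m hX hY
      rw [f1, f0, fm, g1, g0, gm] at hid
      rw [weightOp, weightOp, ← hid]
      refine le_trans ?_ (coupling_drift hn hlt (by linarith) hax hay hmle)
      rw [← sum_coupling_pairBound _ _ _ _ _ _ _ _ _ _ _ _ hX hY]
      have cx : ((x - 1 : ℕ) : ℝ) = x - 1 := by push_cast [hx]; ring
      have cy : ((y - 1 : ℕ) : ℝ) = y - 1 := by push_cast [(by omega : 1 ≤ y)]; ring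
      have b1 := hB (x + 1) (y + 1) (by omega) (by omega) (by omega) (by omega)
      have b2 := hB (x + 1) y (by omega) (by omega) (by omega) (by omega)
      have b4 := hB x (y + 1) (by omega) (by omega) (by omega) (by omega)
      have b5 := hB x y (by omega) (by omega) (by omega) (by omega)
      have b6 := hB x (y - 1) (by omega) (by omega) (by omega) (by omega)
      have b7 := hB (x - 1) (y + 1) (by omega) (by omega) (by omega) (by omega)
      have b8 := hB (x - 1) y (by omega) (by omega) (by omega) (by omega)
      have b9 := hB (x - 1) (y - 1) (by omega) (by omega) (by omega) (by omega)
      have b3 : (up n x * down n y - m) * ((n : ℝ) * σ * (ψ (x + 1) - ψ (y - 1))) ≤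
          (up n x * down n y - m) * pairBound n H r (x + 1) (y - 1) := by
        by_cases h : y = x + 1
        · rw [hm1 h, zero_mul, zero_mul]
        · have b3 := hB (x + 1) (y - 1) (by omega) (by omega) (by omega) (by omega)
          rw [cy] at b3; push_cast at b3
          exact mul_le_mul_of_nonneg_left b3 (by linarith)
      rw [cx] at b7 b8 b9
      rw [cy] at b6 b9
      push_cast at b1 b2 b4 b7
      have c1 := mul_le_mul_of_nonneg_left b1 (mul_nonneg hux huy)
      have c2 := mul_le_mul_of_nonneg_left b2 (add_nonneg (mul_nonneg hux hsy) hm0)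
      have c4 := mul_le_mul_of_nonneg_left b4 (mul_nonneg hsx huy)
      have c5 := mul_le_mul_of_nonneg_left b5 (sub_nonneg.2 hms)
      have c6 := mul_le_mul_of_nonneg_left b6 (add_nonneg (mul_nonneg hsx hdy) hm0)
      have c7 := mul_le_mul_of_nonneg_left b7 (mul_nonneg hdx huy)
      have c8 := mul_le_mul_of_nonneg_left b8 (mul_nonneg hdx hsy)
      have c9 := mul_le_mul_of_nonneg_left b9 (mul_nonneg hdx hdy)
      clear hid hB ih
      linarith
    push_cast
    rcases abs_choice ((weightOp n)^[r + 1] φ x - (weightOp n)^[r + 1] φ y) with h | h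
    · rw [h]; simpa using key 1 (Or.inl rfl)
    · rw [h]; have := key (-1) (Or.inr rfl); linarith

/-! ### The upper bound on the distance to equilibrium -/

theorem piAvg_ind_one {n : ℕ} (hn : 2 ≤ n) :
    piAvg n (fun k => if k = 1 then 1 else 0) = (n : ℝ) / (2 ^ n - 1) := by
  have h1 : 1 ∈ Finset.Icc 1 n := Finset.mem_Icc.2 ⟨le_rfl, by omega⟩
  rw [piAvg, Finset.sum_eq_single ⟨1, h1⟩]
  · simp [weightPi]
  · intro k _ hk
    rw [if_neg, mul_zero]
    exact fun h => hk (Subtype.ext h)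
  · simp

/-- A function that is Lipschitz for the weights `gap` is averaged at the contraction rate, except
for the contribution of the state `1`, which lies far from the others. -/
theorem abs_piAvg_sub_iterate_le {n : ℕ} (hn : 100 ≤ n) {χ : ℕ → ℝ} {Λ S : ℝ} (hΛ : 0 ≤ Λ)
    (h : ∀ k, 1 ≤ k → k < n → |χ (k + 1) - χ k| ≤ Λ * gap n k)
    (h0 : ∀ k, 1 ≤ k → k ≤ n → 0 ≤ χ k) (hS : ∀ k, 1 ≤ k → k ≤ n → χ k ≤ S) (m : ℕ) {k : ℕ}
    (hk : 2 ≤ k) (hkn : k ≤ n) :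
    |piAvg n χ - (weightOp n)^[m] χ k| ≤
      4 * ((1 - contr n) ^ m * Λ) + (n : ℝ) / (2 ^ n - 1) * S := by
  have hn2 : 2 ≤ n := by omega
  obtain ⟨c0, c1⟩ := contr_mem hn
  have hn' : (100 : ℝ) ≤ n := by exact_mod_cast hn
  have c2 : 0 ≤ 1 - contr n := by
    have : 1 / (n : ℝ) ≤ 1 := by rw [div_le_one (by positivity)]; linarith
    linarith
  set Λ' := (1 - contr n) ^ m * Λ with hΛ'
  have hΛ0 : 0 ≤ Λ' := by positivity
  set ψ := (weightOp n)^[m] χ with hψ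
  have hS0 : 0 ≤ S := (h0 1 le_rfl (by omega)).trans (hS 1 le_rfl (by omega))
  have hpt : ∀ y, 1 ≤ y → y ≤ n → |ψ y - ψ k| ≤ 4 * Λ' + S * (if y = 1 then 1 else 0) := by
    intro y hy hyn
    split_ifs with h1
    · have a1 := iterate_weightOp_nonneg hn2 m h0 hy hyn
      have a2 := iterate_weightOp_nonneg hn2 m h0 (by omega : 1 ≤ k) hkn
      have a3 := iterate_weightOp_le hn2 m hS hy hyn
      have a4 := iterate_weightOp_le hn2 m hS (by omega : 1 ≤ k) hkn
      rw [abs_le]; constructor <;> linarith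
    · have := abs_sub_le_of_gap hn hΛ0
        (fun k hk hkn => abs_iterate_succ_sub_le hn hΛ h m hk hkn) (by omega : 2 ≤ y) hyn hk hkn
      linarith
  have e := piAvg_ind_one hn2
  rw [← piAvg_iterate hn2 m χ, ← hψ, abs_le]
  constructor
  · have h1 := piAvg_mono hn2 (φ := fun y => -S * (if y = 1 then 1 else 0) + 0 * ψ y +
        (ψ k - 4 * Λ')) (χ := ψ) (fun y hy hyn => by
        have := (abs_le.1 (hpt y hy hyn)).1; linarith)
    rw [piAvg_lin hn2, e] at h1
    linarith
  · have h1 := piAvg_mono hn2 (φ := ψ) (χ := fun y => S * (if y = 1 then 1 else 0) + 0 * ψ y +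
        (ψ k + 4 * Λ')) (fun y hy hyn => by
        have := (abs_le.1 (hpt y hy hyn)).2; linarith)
    rw [piAvg_lin hn2, e] at h1
    linarith

/-- The fourth root of `n`. -/
noncomputable def root4 (n : ℕ) : ℝ := √√(n : ℝ)

theorem root4_facts {n : ℕ} (hn : 10000 ≤ n) : 10 ≤ root4 n ∧ root4 n ^ 4 = n := by
  have hn' : (10000 : ℝ) ≤ n := by exact_mod_cast hn
  refine ⟨Real.le_sqrt_of_sq_le (Real.le_sqrt_of_sq_le (by norm_num; linarith)), ?_⟩
  rw [root4, show (4 : ℕ) = 2 * 2 from rfl, pow_mul, Real.sq_sqrt (Real.sqrt_nonneg _),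
    Real.sq_sqrt (by linarith)]

theorem abs_recip {n k : ℕ} (hk : 1 ≤ k) :
    |recip n k| = |(n : ℝ) + 1 - 2 * k| / (k * (n + 1)) := by
  have hk' : (1 : ℝ) ≤ k := by exact_mod_cast hk
  have : recip n k = ((n : ℝ) + 1 - 2 * k) / (k * (n + 1)) := by
    rw [recip]; field_simp
  rw [this, abs_div, abs_of_pos (by positivity : (0 : ℝ) < k * (n + 1))]

/-- After `n` steps a function with values in `[0, 1]` is Lipschitz for the weights `gap`, except
at distance more than about `n ^ (3 / 4)` from `n / 2`; there it is made constant. -/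
theorem exists_lipschitz_approx {n : ℕ} (hn : 10000 ≤ n) {φ : ℕ → ℝ}
    (h0 : ∀ k, 1 ≤ k → k ≤ n → 0 ≤ φ k) (h1 : ∀ k, 1 ≤ k → k ≤ n → φ k ≤ 1) :
    ∃ χ : ℕ → ℝ, (∀ k, 1 ≤ k → k < n → |χ (k + 1) - χ k| ≤ 2000 * root4 n ^ 6 * gap n k) ∧
      (∀ k, 1 ≤ k → k ≤ n → 0 ≤ χ k) ∧ (∀ k, 1 ≤ k → k ≤ n → χ k ≤ 1) ∧
      ∀ k, 1 ≤ k → k ≤ n → |(weightOp n)^[n] φ k - χ k| ≤ root4 n ^ 5 * |recip n k| := by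
  obtain ⟨hq, hqn⟩ := root4_facts hn
  set q := root4 n with hqdef
  have hn2 : 2 ≤ n := by omega
  have hq2 : 0 < q ^ 2 := by positivity
  have hq3 : (1000 : ℝ) ≤ q ^ 3 := by
    calc (1000 : ℝ) = 10 ^ 3 := by norm_num
      _ ≤ q ^ 3 := by gcongr
  obtain ⟨m, hm⟩ : ∃ m : ℕ, m = ⌈q ^ 3⌉₊ := ⟨_, rfl⟩
  have hm1 : q ^ 3 ≤ m := hm ▸ Nat.le_ceil _
  have hm2 : (m : ℝ) ≤ 2 * q ^ 3 := by
    have := (Nat.ceil_lt_add_one (by positivity : 0 ≤ q ^ 3)).le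
    rw [← hm] at this; linarith
  have hm3 : 4 * m ≤ n := by
    have : 4 * (m : ℝ) ≤ n := by rw [← hqn]; nlinarith
    exact_mod_cast this
  obtain ⟨lo, hlo⟩ : ∃ lo, lo = (n + 1) / 2 - m := ⟨_, rfl⟩
  obtain ⟨hi, hhi⟩ : ∃ hi, hi = (n + 1) / 2 + m := ⟨_, rfl⟩
  have hlo1 : 1 ≤ lo := by omega
  have hhin : hi ≤ n := by omega
  have hlohi : lo ≤ hi := by omega
  obtain ⟨H, hH⟩ : ∃ H : ℕ, H = ⌈q ^ 2⌉₊ := ⟨_, rfl⟩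
  have hH1 : q ^ 2 ≤ H := hH ▸ Nat.le_ceil _
  have hH2 : (H : ℝ) ≤ 2 * q ^ 2 := by
    have := (Nat.ceil_lt_add_one (by positivity : 0 ≤ q ^ 2)).le
    rw [← hH] at this; nlinarith
  have hHn : n ≤ H ^ 2 := by
    have : (n : ℝ) ≤ (H : ℝ) ^ 2 := by
      rw [← hqn, show q ^ 4 = (q ^ 2) ^ 2 by ring]; gcongr
    exact_mod_cast this
  set ψ := (weightOp n)^[n] φ with hψ
  set c : ℕ → ℕ := fun k => max lo (min k hi) with hc
  have hcmem : ∀ k, 1 ≤ c k ∧ c k ≤ n := fun k => by simp only [hc]; omega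
  have hψ0 : ∀ k, 1 ≤ k → k ≤ n → 0 ≤ ψ k := fun k hk hkn =>
    iterate_weightOp_nonneg hn2 n h0 hk hkn
  have hψ1 : ∀ k, 1 ≤ k → k ≤ n → ψ k ≤ 1 := fun k hk hkn =>
    iterate_weightOp_le hn2 n h1 hk hkn
  have hedge : ∀ k, 1 ≤ k → k < n → lo ≤ k → k + 1 ≤ hi →
      |ψ (k + 1) - ψ k| ≤ 2000 * q ^ 6 * gap n k := by
    intro k hk hkn hklo hkhi
    have hb := abs_iterate_sub_le_pairBound (by omega) hHn h0 h1 le_rfl hk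
      (Nat.le_succ k) (by omega) (by
        have : (1 : ℝ) ≤ H := by nlinarith
        have : 1 ≤ H := by exact_mod_cast this
        omega)
    rw [← hψ, abs_sub_comm] at hb
    have ha : ∀ j : ℕ, lo ≤ j → j ≤ hi → ((n : ℝ) + 1 - 2 * j) ^ 2 ≤ 25 * q ^ 6 := by
      intro j hj1 hj2
      have e1 : (n : ℝ) + 1 ≤ 2 * j + 2 * m + 1 := by
        exact_mod_cast (by omega : n + 1 ≤ 2 * j + 2 * m + 1)
      have e2 : 2 * (j : ℝ) ≤ n + 1 + 2 * m := by
        exact_mod_cast (by omega : 2 * j ≤ n + 1 + 2 * m)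
      have e3 : |(n : ℝ) + 1 - 2 * j| ≤ 5 * q ^ 3 := abs_le.2 ⟨by linarith, by linarith⟩
      rw [← sq_abs]
      calc _ ≤ (5 * q ^ 3) ^ 2 := by gcongr
        _ = _ := by ring
    have a1 := ha k hklo (by omega)
    have a2 := ha (k + 1) (by omega) hkhi
    have hb2 : (n : ℝ) * |ψ (k + 1) - ψ k| ≤ 2000 * q ^ 2 := by
      refine hb.trans ?_
      have : 25 / (n : ℝ) * (((n : ℝ) + 1 - 2 * k) ^ 2 + ((n : ℝ) + 1 - 2 * (k + 1 : ℕ)) ^ 2) ≤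
          1250 * q ^ 2 := by
        calc _ ≤ 25 / (n : ℝ) * (25 * q ^ 6 + 25 * q ^ 6) := by gcongr
          _ = _ := by rw [← hqn]; field_simp; norm_num
      simp only [pairBound]
      push_cast at this ⊢
      nlinarith
    have hg := inv_sq_le_gap (by omega) hk hkn
    have hn0 : (0 : ℝ) < n := by rw [← hqn]; positivity
    calc |ψ (k + 1) - ψ k| ≤ 2000 * q ^ 2 / n := by rw [le_div_iff₀ hn0]; linarith
      _ = 2000 * q ^ 6 * (1 / (n : ℝ) ^ 2) := by rw [← hqn]; field_simp
      _ ≤ _ := by gcongr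
  refine ⟨fun k => ψ (c k), ?_, fun k _ _ => hψ0 _ (hcmem k).1 (hcmem k).2,
    fun k _ _ => hψ1 _ (hcmem k).1 (hcmem k).2, ?_⟩
  · intro k hk hkn
    rcases (by omega : (lo ≤ k ∧ k + 1 ≤ hi) ∨ k < lo ∨ hi ≤ k) with h | h
    · have e1 : c k = k := by simp only [hc]; omega
      have e2 : c (k + 1) = k + 1 := by simp only [hc]; omega
      simp only [e1, e2]
      exact hedge k hk hkn h.1 h.2
    · have e : c (k + 1) = c k := by simp only [hc]; omega
      simp only [e, sub_self, abs_zero]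
      have := gap_pos (by omega) hk hkn
      positivity
  · intro k hk hkn
    by_cases h : lo ≤ k ∧ k ≤ hi
    · have e1 : c k = k := by simp only [hc]; omega
      simp only [e1, sub_self, abs_zero]
      positivity
    · have hk' : (1 : ℝ) ≤ k := by exact_mod_cast hk
      have hkn' : (k : ℝ) ≤ n := by exact_mod_cast hkn
      have hn0 : (0 : ℝ) < n := by linarith
      have b1 : |ψ k - ψ (c k)| ≤ 1 := by
        have a1 := hψ0 k hk hkn
        have a2 := hψ1 k hk hkn
        have a3 := hψ0 _ (hcmem k).1 (hcmem k).2
        have a4 := hψ1 _ (hcmem k).1 (hcmem k).2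
        rw [abs_le]; constructor <;> linarith
      refine b1.trans ?_
      have b2 : 2 * q ^ 3 ≤ |(n : ℝ) + 1 - 2 * k| := by
        rw [le_abs]
        rcases (by omega : k < lo ∨ hi < k) with h | h
        · left
          have : 2 * (k : ℝ) + 2 * m ≤ n + 1 := by exact_mod_cast (by omega : 2 * k + 2 * m ≤ n + 1)
          linarith
        · right
          have : (n : ℝ) + 1 + 2 * m ≤ 2 * k := by exact_mod_cast (by omega : n + 1 + 2 * m ≤ 2 * k)
          linarith
      rw [abs_recip hk, mul_div_assoc', le_div_iff₀ (by positivity), one_mul]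
      calc (k : ℝ) * (n + 1) ≤ n * (n + n) := by gcongr; linarith
        _ = q ^ 5 * (2 * q ^ 3) := by rw [← hqn]; ring
        _ ≤ _ := by gcongr

theorem piAvg_abs_recip_le {n : ℕ} (hn : 10000 ≤ n) :
    piAvg n (fun k => |recip n k|) ≤ 160001 / root4 n ^ 6 := by
  obtain ⟨hq, hqn⟩ := root4_facts hn
  set q := root4 n
  have hn2 : 2 ≤ n := by omega
  have h := piAvg_mono hn2 (φ := fun k => |recip n k|)
    (χ := fun k => q ^ 6 / 2 * recip n k ^ 2 + 0 * recip n k ^ 2 + 1 / (2 * q ^ 6))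
    (fun k _ _ => by
      have : 0 ≤ (q ^ 6 * |recip n k| - 1) ^ 2 / (2 * q ^ 6) := by positivity
      have e : (q ^ 6 * |recip n k| - 1) ^ 2 / (2 * q ^ 6) =
          q ^ 6 / 2 * |recip n k| ^ 2 - |recip n k| + 1 / (2 * q ^ 6) := by
        field_simp; ring
      rw [e, sq_abs] at this
      linarith)
  rw [piAvg_lin hn2] at h
  have h2 := piAvg_recip_sq_le hn2
  calc _ ≤ _ := h
    _ ≤ q ^ 6 / 2 * (320000 / (n : ℝ) ^ 3) + 1 / (2 * q ^ 6) := by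
      rw [zero_mul, add_zero]; gcongr
    _ ≤ _ := by
      rw [← hqn, ← sub_nonneg]
      have : 160001 / q ^ 6 - (q ^ 6 / 2 * (320000 / (q ^ 4) ^ 3) + 1 / (2 * q ^ 6)) =
        1 / (2 * q ^ 6) := by field_simp; norm_num
      rw [this]; positivity

/-- The bound on the distance to equilibrium at time `m + n`, from a weight at least `2`. -/
noncomputable def mixBound (n m : ℕ) : ℝ :=
  320002 / root4 n + 8004 * root4 n ^ 6 * (1 - contr n) ^ m +
    (n : ℝ) / (2 ^ n - 1) * (1 + root4 n ^ 5)

/-- The smoothed function differs from its Lipschitz approximation by at most a multiple of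
`|recip|`, which is itself Lipschitz and has a small stationary mean. -/
theorem piAvg_sub_iterate_le_mixBound {n : ℕ} (hn : 10000 ≤ n) {φ : ℕ → ℝ}
    (h0 : ∀ k, 1 ≤ k → k ≤ n → 0 ≤ φ k) (h1 : ∀ k, 1 ≤ k → k ≤ n → φ k ≤ 1) (m : ℕ) {k : ℕ}
    (hk : 2 ≤ k) (hkn : k ≤ n) :
    piAvg n φ - (weightOp n)^[m + n] φ k ≤ mixBound n m := by
  obtain ⟨hq, hqn⟩ := root4_facts hn
  obtain ⟨χ, hχ, hχ0, hχ1, hχψ⟩ := exists_lipschitz_approx hn h0 h1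
  have hn2 : 2 ≤ n := by omega
  rw [mixBound]
  set q := root4 n with hqdef
  have hn' : (10000 : ℝ) ≤ n := by exact_mod_cast hn
  rw [Function.iterate_add_apply, ← piAvg_iterate hn2 n φ]
  set ψ := (weightOp n)^[n] φ with hψ
  set L := (1 - contr n) ^ m with hL
  have hL0 : 0 ≤ L := by
    obtain ⟨c0, c1⟩ := contr_mem (by omega : 100 ≤ n)
    have : 1 / (n : ℝ) ≤ 1 := by rw [div_le_one (by positivity)]; linarith
    exact pow_nonneg (by linarith) m
  have hπ : 0 ≤ (n : ℝ) / (2 ^ n - 1) := div_nonneg (by positivity) (two_pow_sub_one_pos hn2).le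
  set θ : ℕ → ℝ := fun k => q ^ 5 * |recip n k| with hθ
  have hθlip : ∀ k, 1 ≤ k → k < n → |θ (k + 1) - θ k| ≤ q ^ 5 * gap n k := by
    intro k hk hkn
    simp only [hθ]
    rw [← mul_sub, abs_mul, abs_of_nonneg (by positivity : 0 ≤ q ^ 5)]
    gcongr
    exact (abs_abs_sub_abs_le_abs_sub _ _).trans (abs_recip_sub_le_gap (by omega) hk hkn)
  have hθ1 : ∀ k, 1 ≤ k → k ≤ n → θ k ≤ q ^ 5 := by
    intro k hk _
    have hk' : (1 : ℝ) ≤ k := by exact_mod_cast hk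
    have b1 : 1 / (k : ℝ) ≤ 1 := by rw [div_le_one (by positivity)]; exact hk'
    have b2 : 0 ≤ 1 / (k : ℝ) := by positivity
    have b3 : 2 / ((n : ℝ) + 1) ≤ 1 := by rw [div_le_one (by positivity)]; linarith
    have b4 : 0 ≤ 2 / ((n : ℝ) + 1) := by positivity
    have : |recip n k| ≤ 1 := by rw [recip, abs_le]; constructor <;> linarith
    calc θ k ≤ q ^ 5 * 1 := by simp only [hθ]; gcongr
      _ = _ := mul_one _
  have e1 := (abs_le.1 (abs_piAvg_sub_iterate_le (by omega) (by positivity) hχ hχ0 hχ1 m hk hkn)).2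
  have e2 := (abs_le.1 (abs_piAvg_sub_iterate_le (by omega) (by positivity) hθlip
    (fun k _ _ => by positivity) hθ1 m hk hkn)).1
  have e3 : piAvg n θ ≤ 160001 / q := by
    have h := piAvg_lin hn2 (q ^ 5) 0 0 (fun k => |recip n k|) (fun k => |recip n k|)
    simp only [zero_mul, add_zero] at h
    rw [hθ, h]
    calc _ ≤ q ^ 5 * (160001 / q ^ 6) := by
          gcongr; exact piAvg_abs_recip_le hn
      _ = _ := by field_simp
  have e4 : piAvg n ψ ≤ piAvg n χ + piAvg n θ := by
    have h := piAvg_mono hn2 (φ := ψ) (χ := fun k => 1 * χ k + 1 * θ k + 0) (fun k hk hkn => by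
      have := (abs_le.1 (hχψ k hk hkn)).2
      simp only [hθ]; linarith)
    rwa [piAvg_lin hn2, one_mul, one_mul, add_zero] at h
  have e5 : (weightOp n)^[m] χ k - (weightOp n)^[m] θ k ≤ (weightOp n)^[m] ψ k := by
    have h := iterate_weightOp_mono hn2 m (φ := fun k => 1 * χ k + (-1) * θ k + 0) (χ := ψ)
      (fun k hk hkn => by
        have := (abs_le.1 (hχψ k hk hkn)).1
        simp only [hθ]; linarith) (by omega : 1 ≤ k) hkn
    rw [iterate_weightOp_lin hn2] at h
    linarith
  have e6 : q ^ 5 ≤ q ^ 6 := pow_le_pow_right₀ (by linarith) (by norm_num)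
  have e7 : L * q ^ 5 ≤ L * q ^ 6 := by gcongr
  have e8 : 320002 / q = 160001 / q + 160001 / q := by ring
  rw [e8]
  linarith

theorem piAvg_ind_le_one {n : ℕ} (hn : 2 ≤ n) (A : Finset (Weight n)) :
    piAvg n (ind A) ≤ 1 := by
  rw [piAvg_ind, ← sum_weightPi hn]
  exact Finset.sum_le_sum_of_subset_of_nonneg (Finset.subset_univ A)
    fun k _ _ => (weightPi_pos hn k).le

theorem iterate_succ_one {n : ℕ} (hn : 2 ≤ n) (t : ℕ) (φ : ℕ → ℝ) :
    (weightOp n)^[t + 1] φ 1 =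
      1 / n * (weightOp n)^[t] φ 2 + (1 - 1 / n) * (weightOp n)^[t] φ 1 := by
  rw [Function.iterate_succ_apply', weightOp, down_one]
  have hn' : (2 : ℝ) ≤ n := by exact_mod_cast hn
  have h1 : (n : ℝ) - 1 ≠ 0 := by linarith
  have : up n 1 = 1 / n := by rw [up]; push_cast; field_simp
  rw [this]
  push_cast
  ring

/-- From the weight `1`, the chain first waits a geometric time with mean `n`. -/
theorem weightDist_le {n : ℕ} (hn : 10000 ≤ n) (i m : ℕ) :
    weightDist n (i + (m + n)) ≤ mixBound n m + (1 - 1 / (n : ℝ)) ^ i := by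
  have hn2 : 2 ≤ n := by omega
  obtain ⟨hq, hqn⟩ := root4_facts hn
  have hn' : (10000 : ℝ) ≤ n := by exact_mod_cast hn
  obtain ⟨c0, c1⟩ := contr_mem (by omega : 100 ≤ n)
  have hinv : 1 / (n : ℝ) ≤ 1 := by rw [div_le_one (by positivity)]; linarith
  have hinv0 : 0 < 1 / (n : ℝ) := by positivity
  have hanti : ∀ j, mixBound n (j + m) ≤ mixBound n m := by
    intro j
    have : (1 - contr n) ^ (j + m) ≤ (1 - contr n) ^ m :=
      pow_le_pow_of_le_one (by linarith) (by linarith) (by omega)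
    rw [mixBound, mixBound]
    gcongr
  have hB0 : 0 ≤ mixBound n m := by
    have h1 : 0 ≤ 1 - contr n := by linarith
    have h2 : 0 ≤ (n : ℝ) / (2 ^ n - 1) :=
      div_nonneg (by positivity) (two_pow_sub_one_pos hn2).le
    rw [mixBound]; positivity
  have hne : Nonempty (Weight n) := ⟨⟨1, Finset.mem_Icc.2 ⟨le_rfl, by omega⟩⟩⟩
  refine ciSup_le fun k => ciSup_le fun A => ?_
  rw [sum_weightP_pow hn2, ← piAvg_ind]
  have h0 : ∀ k, 1 ≤ k → k ≤ n → 0 ≤ ind A k := fun k _ _ => ind_nonneg A k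
  have h1 : ∀ k, 1 ≤ k → k ≤ n → ind A k ≤ 1 := fun k _ _ => ind_le_one A k
  obtain ⟨hk1, hkn⟩ := Finset.mem_Icc.1 k.2
  rcases hk1.eq_or_lt with hk | hk
  · rw [← hk]
    clear hk hk1 hkn
    induction i with
    | zero =>
      have a1 := iterate_weightOp_nonneg hn2 (0 + (m + n)) h0 le_rfl (by omega)
      have a2 := piAvg_ind_le_one hn2 A
      rw [pow_zero]
      linarith
    | succ i ih =>
      have e : i + 1 + (m + n) = (i + (m + n)) + 1 := by ring
      rw [e, iterate_succ_one hn2]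
      have h2 := piAvg_sub_iterate_le_mixBound hn h0 h1 (i + m) (le_refl 2) hn2
      have h3 := hanti i
      rw [add_assoc] at h2
      have b1 := mul_le_mul_of_nonneg_left (h2.trans h3) hinv0.le
      have b2 := mul_le_mul_of_nonneg_left ih (by linarith : 0 ≤ 1 - 1 / (n : ℝ))
      rw [pow_succ]
      linarith
  · have h2 := piAvg_sub_iterate_le_mixBound hn h0 h1 (i + m) hk hkn
    have h3 := hanti i
    rw [add_assoc] at h2
    have : 0 ≤ (1 - 1 / (n : ℝ)) ^ i := pow_nonneg (by linarith) i
    linarith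

/-! ### The lower bound on the distance to equilibrium -/

theorem iterate_natCast_le {n : ℕ} (hn : 2 ≤ n) (s : ℕ) {k : ℕ} (hk : 1 ≤ k) (hkn : k ≤ n) :
    (weightOp n)^[s] (fun k => (k : ℝ)) k ≤ (1 + 1 / (n : ℝ)) ^ s * k := by
  have h := le_iterate_weightOp_of_drift hn
    (f := fun k => (-1) * (k : ℝ) + 0 * (k : ℝ) + 0) (a := 1 + 1 / (n : ℝ))
    (by positivity) (fun j hj _ => by
      rw [weightOp_lin hn]
      have := weightOp_natCast_le hn hj
      linarith) s hk hkn
  rw [iterate_weightOp_lin hn] at h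
  linarith

theorem iterate_lowPot_two_le {n : ℕ} (hn : 100 ≤ n) (s : ℕ) :
    (weightOp n)^[s] (lowPot n) 2 ≤ (1 - contr n) ^ s + 5 / n := by
  obtain ⟨c0, c1⟩ := contr_mem hn
  obtain ⟨hS, -⟩ := sqrt_facts hn
  have hn' : (100 : ℝ) ≤ n := by exact_mod_cast hn
  have hinv : 1 / (n : ℝ) ≤ 1 := by rw [div_le_one (by positivity)]; linarith
  have hN : (0 : ℝ) < (n : ℝ) * ((n : ℝ) - 1) := by nlinarith
  have h := iterate_weightOp_le_of_drift (by omega : 2 ≤ n) (f := lowPot n)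
    (a := 1 - contr n) (b := 2 / ((n : ℝ) * ((n : ℝ) - 1))) (by linarith) (by linarith)
    (by positivity) (fun k hk _ => weightOp_lowPot_le hn hk) s (by norm_num : 1 ≤ 2) (by omega : 2 ≤ n)
  have h2 : lowPot n 2 = 1 := by rw [lowPot]; norm_num
  rw [h2, mul_one, sub_sub_cancel] at h
  refine h.trans (add_le_add_right ?_ _)
  have h3 : 1 / (2 * n) ≤ contr n := by
    have : 5 / √(n : ℝ) ≤ 1 / 2 := by rw [div_le_div_iff₀ (by linarith) (by norm_num)]; linarith
    rw [contr, div_le_div_iff₀ (by positivity) (by positivity)]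
    nlinarith
  have hn1 : (0 : ℝ) < n - 1 := by linarith
  calc 2 / ((n : ℝ) * (n - 1)) / contr n ≤ 2 / ((n : ℝ) * (n - 1)) / (1 / (2 * n)) := by gcongr
    _ = 4 / (n - 1) := by field_simp; norm_num
    _ ≤ 5 / n := by rw [div_le_div_iff₀ hn1 (by positivity)]; linarith

theorem one_div_le_lowPot {n k : ℕ} (hn : 100 ≤ n) (hk : 1 ≤ k) : 1 / (k : ℝ) ≤ lowPot n k := by
  obtain ⟨hS, -⟩ := sqrt_facts hn
  rw [lowPot]
  split_ifs with h
  · subst h; norm_num; linarith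
  · have : (2 : ℝ) ≤ k := by exact_mod_cast (by omega : 2 ≤ k)
    exact one_div_le_one_div_of_le (by linarith) (by linarith)

/-- From a weight `k ≤ n / 8`, Chebyshev's inequality shows that after `t` steps `recip` is still
at least half of the lower bound on its mean. -/
theorem iterate_le_of_recip_le {n : ℕ} (hn : 100 ≤ n) (t : ℕ) {φ : ℕ → ℝ}
    (h1 : ∀ j, φ j ≤ 1)
    (hφ : ∀ j, 1 ≤ j → 6 / n * (1 - relax n) ^ t / 2 < recip n j → φ j ≤ 0)
    {k : ℕ} (hk : 1 ≤ k) (hkn : k ≤ n) (hk8 : 8 * k ≤ n) :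
    (weightOp n)^[t] φ k ≤
      80 * (invCube k + 16000 / (n : ℝ) ^ 3) / (6 / n * (1 - relax n) ^ t) ^ 2 := by
  have hn2 : 2 ≤ n := by omega
  have hn' : (100 : ℝ) ≤ n := by exact_mod_cast hn
  have hk' : (1 : ℝ) ≤ k := by exact_mod_cast hk
  have hk8' : 8 * (k : ℝ) ≤ n := by exact_mod_cast hk8
  have hr := relax_pos hn2
  have hr1 : relax n ≤ 1 / 2 := by
    rw [relax, div_le_div_iff₀ (by nlinarith) (by norm_num)]; nlinarith
  have hpow : 0 < (1 - relax n) ^ t := pow_pos (by linarith) t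
  set μ := 6 / n * (1 - relax n) ^ t with hμ
  have hμ0 : 0 < μ := by positivity
  set M := (1 - relax n) ^ t * recip n k with hM
  have hRk : 6 / n ≤ recip n k := by
    have b1 : 8 / (n : ℝ) ≤ 1 / k := by rw [div_le_div_iff₀ (by positivity) (by positivity)]; linarith
    have b2 : 2 / ((n : ℝ) + 1) ≤ 2 / n := by gcongr; linarith
    have b3 : 8 / (n : ℝ) = 6 / n + 2 / n := by ring
    rw [recip]; linarith
  have hμM : μ ≤ M := by rw [hμ, hM, mul_comm]; gcongr
  have hmean : M ≤ (weightOp n)^[t] (recip n) k :=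
    le_iterate_weightOp_of_drift hn2 (by linarith) (fun j hj _ => le_weightOp_recip hn2 hj) t hk hkn
  have hsq := iterate_recip_sq_le (by omega : 4 ≤ n) t hk hkn
  have hpow2 : (1 - 2 * relax n) ^ t * recip n k ^ 2 ≤ M ^ 2 := by
    rw [hM, mul_pow, ← pow_mul, mul_comm t 2, pow_mul]
    gcongr
    · linarith
    · nlinarith
  -- the indicator is at most `(recip - M) ^ 2` over `(μ / 2) ^ 2`
  have hdom : ∀ j, 1 ≤ j → j ≤ n → φ j ≤
      4 / μ ^ 2 * recip n j ^ 2 + (-(8 * M / μ ^ 2)) * recip n j + 4 * M ^ 2 / μ ^ 2 := by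
    intro j hj _
    have e : 4 / μ ^ 2 * recip n j ^ 2 + (-(8 * M / μ ^ 2)) * recip n j + 4 * M ^ 2 / μ ^ 2 =
      (2 * (M - recip n j)) ^ 2 / μ ^ 2 := by field_simp; ring
    rw [e]
    rcases lt_or_ge (μ / 2) (recip n j) with h | h
    · exact (hφ j hj h).trans (by positivity)
    · refine (h1 j).trans ?_
      rw [one_le_div (by positivity)]
      gcongr
      linarith
  have h := iterate_weightOp_mono hn2 t hdom hk hkn
  rw [iterate_weightOp_lin hn2] at h
  refine h.trans ?_
  have e : 4 / μ ^ 2 * (weightOp n)^[t] (fun j => recip n j ^ 2) k +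
      (-(8 * M / μ ^ 2)) * (weightOp n)^[t] (recip n) k + 4 * M ^ 2 / μ ^ 2 =
      (4 * (weightOp n)^[t] (fun j => recip n j ^ 2) k -
        8 * M * (weightOp n)^[t] (recip n) k + 4 * M ^ 2) / μ ^ 2 := by ring
  refine e.trans_le ?_
  gcongr
  have hM0 : 0 ≤ M := hμ0.le.trans hμM
  nlinarith

theorem le_weightDist {n : ℕ} (t : ℕ) (k : Weight n) (A : Finset (Weight n)) :
    ∑ l ∈ A, weightPi n l - ∑ l ∈ A, (weightP n ^ t) k l ≤ weightDist n t := by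
  refine le_trans ?_ (le_ciSup (f := fun k => tvDist ((weightP n ^ t) k) (weightPi n))
    (Set.finite_range _).bddAbove k)
  exact le_ciSup (f := fun A : Finset (Weight n) =>
    ∑ l ∈ A, weightPi n l - ∑ l ∈ A, (weightP n ^ t) k l) (Set.finite_range _).bddAbove A

theorem weightDist_nonneg {n : ℕ} (hn : 2 ≤ n) (t : ℕ) : 0 ≤ weightDist n t := by
  have h := le_weightDist t ⟨1, Finset.mem_Icc.2 ⟨le_rfl, by omega⟩⟩ (∅ : Finset (Weight n))
  simpa using h

theorem weightDist_le_one {n : ℕ} (hn : 2 ≤ n) (t : ℕ) : weightDist n t ≤ 1 := by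
  have hne : Nonempty (Weight n) := ⟨⟨1, Finset.mem_Icc.2 ⟨le_rfl, by omega⟩⟩⟩
  refine ciSup_le fun k => ciSup_le fun A => ?_
  obtain ⟨hk1, hkn⟩ := Finset.mem_Icc.1 k.2
  have h1 := piAvg_ind_le_one hn A
  have h2 := iterate_weightOp_nonneg hn t (fun k _ _ => ind_nonneg A k) hk1 hkn
  rw [sum_weightP_pow hn, ← piAvg_ind]
  linarith

/-- Lower bound at time `s + t`, from the weight `2`. The first `s` steps bring the weight between
`δ n` and `n / 8`; after the next `t` steps `recip` is still large compared to its equilibrium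
fluctuations. -/
theorem one_sub_le_weightDist {n : ℕ} (hn : 100 ≤ n) (s t : ℕ) {δ : ℝ} (hδ : 0 < δ) :
    1 - (16 * (1 + 1 / (n : ℝ)) ^ s / n + δ * n * ((1 - contr n) ^ s + 5 / n) +
      (2560000 + 80 / δ ^ 3) / ((n : ℝ) ^ 3 * (6 / n * (1 - relax n) ^ t) ^ 2)) ≤
      weightDist n (s + t) := by
  have hn2 : 2 ≤ n := by omega
  have hn' : (100 : ℝ) ≤ n := by exact_mod_cast hn
  have hn0 : (0 : ℝ) < n := by linarith
  have hr1 : relax n ≤ 1 / 2 := by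
    rw [relax, div_le_div_iff₀ (by nlinarith) (by norm_num)]; nlinarith
  have hpow : 0 < (1 - relax n) ^ t := pow_pos (by linarith) t
  have hcheb := fun {φ : ℕ → ℝ} => iterate_le_of_recip_le hn t (φ := φ)
  set μ := 6 / n * (1 - relax n) ^ t with hμ
  have hμ0 : 0 < μ := by positivity
  set A : Finset (Weight n) := Finset.univ.filter fun k => recip n k.1 ≤ μ / 2 with hA
  have hindA : ∀ j, 1 ≤ j → j ≤ n → recip n j ≤ μ / 2 → ind A j = 1 := by
    intro j hj hjn h
    have := ind_coe A ⟨j, Finset.mem_Icc.2 ⟨hj, hjn⟩⟩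
    rw [if_pos (by simp [hA, h])] at this
    exact this
  have hindA' : ∀ j, 1 ≤ j → μ / 2 < recip n j → ind A j ≤ 0 := by
    intro j hj h
    rw [ind, if_neg]
    rintro ⟨a, ha, rfl⟩
    have := (Finset.mem_filter.1 ha).2
    linarith
  have hπA : 1 - 1280000 / ((n : ℝ) ^ 3 * μ ^ 2) ≤ piAvg n (ind A) := by
    have h := piAvg_mono hn2
      (φ := fun j => (-(4 / μ ^ 2)) * recip n j ^ 2 + 0 * recip n j ^ 2 + 1) (χ := ind A)
      (fun j hj hjn => by
        rcases lt_or_ge (μ / 2) (recip n j) with h | h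
        · have : 1 ≤ 4 / μ ^ 2 * recip n j ^ 2 := by
            rw [div_mul_eq_mul_div, one_le_div (by positivity)]
            nlinarith
          have := ind_nonneg A j
          linarith
        · rw [hindA j hj hjn h]
          have : 0 ≤ 4 / μ ^ 2 * recip n j ^ 2 := by positivity
          linarith)
    rw [piAvg_lin hn2] at h
    have h2 : 4 / μ ^ 2 * piAvg n (fun j => recip n j ^ 2) ≤ 1280000 / ((n : ℝ) ^ 3 * μ ^ 2) := by
      calc _ ≤ 4 / μ ^ 2 * (320000 / (n : ℝ) ^ 3) := by
            gcongr; exact piAvg_recip_sq_le hn2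
        _ = _ := by field_simp; norm_num
    linarith
  set K := 80 * (1 / (δ * n) ^ 3 + 16000 / (n : ℝ) ^ 3) / μ ^ 2 with hK
  have hK0 : 0 ≤ K := by positivity
  have hpt : ∀ k, 1 ≤ k → k ≤ n →
      (weightOp n)^[t] (ind A) k ≤ 8 / n * k + δ * n * lowPot n k + K := by
    intro k hk hkn
    have hk' : (1 : ℝ) ≤ k := by exact_mod_cast hk
    have a1 : (weightOp n)^[t] (ind A) k ≤ 1 :=
      iterate_weightOp_le hn2 t (fun j _ _ => ind_le_one A j) hk hkn
    have a2 : 0 ≤ 8 / (n : ℝ) * k := by positivity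
    have a3 := one_div_le_lowPot hn hk
    have a4 : δ * n * (1 / (k : ℝ)) ≤ δ * n * lowPot n k := by gcongr
    have a5 : 0 ≤ δ * n * (1 / (k : ℝ)) := by positivity
    rcases (by omega : n < 8 * k ∨ 8 * k ≤ n) with h | h
    · have : 1 ≤ 8 / (n : ℝ) * k := by
        rw [div_mul_eq_mul_div, one_le_div hn0]; exact_mod_cast h.le
      linarith
    rcases lt_or_ge (k : ℝ) (δ * n) with h' | h'
    · have : 1 ≤ δ * n * (1 / (k : ℝ)) := by
        rw [mul_one_div, one_le_div (by positivity)]; exact h'.le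
      linarith
    · have h3 := hcheb (fun j => ind_le_one A j) hindA' hk hkn h
      have h4 : invCube k ≤ 1 / (δ * n) ^ 3 := by
        rw [invCube]
        apply one_div_le_one_div_of_le (by positivity)
        calc (δ * n) ^ 3 ≤ (k : ℝ) ^ 3 := by gcongr
          _ = (k : ℝ) * k * k := by ring
          _ ≤ _ := by gcongr <;> linarith
      have h5 : (weightOp n)^[t] (ind A) k ≤ K := by
        refine h3.trans ?_
        rw [hK]; gcongr
      linarith
  have hup : (weightOp n)^[s + t] (ind A) 2 ≤ 16 * (1 + 1 / (n : ℝ)) ^ s / n +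
      δ * n * ((1 - contr n) ^ s + 5 / n) + K := by
    rw [Function.iterate_add_apply]
    have h := iterate_weightOp_mono hn2 s hpt (by norm_num : 1 ≤ 2) hn2
    rw [iterate_weightOp_lin hn2 s _ _ _ (fun k : ℕ => (k : ℝ))] at h
    refine h.trans ?_
    have e : 16 * (1 + 1 / (n : ℝ)) ^ s / n = 8 / n * ((1 + 1 / (n : ℝ)) ^ s * (2 : ℕ)) := by
      push_cast; ring
    have b1 := mul_le_mul_of_nonneg_left (iterate_natCast_le hn2 s (by norm_num : 1 ≤ 2) hn2)
      (by positivity : 0 ≤ 8 / (n : ℝ))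
    have b2 := mul_le_mul_of_nonneg_left (iterate_lowPot_two_le hn s)
      (by positivity : 0 ≤ δ * n)
    rw [e]
    linarith
  have h := le_weightDist (s + t) ⟨2, Finset.mem_Icc.2 ⟨by norm_num, hn2⟩⟩ A
  rw [sum_weightP_pow hn2, ← piAvg_ind] at h
  have e : (2560000 + 80 / δ ^ 3) / ((n : ℝ) ^ 3 * μ ^ 2) =
      1280000 / ((n : ℝ) ^ 3 * μ ^ 2) + K := by
    rw [hK]; field_simp; ring
  rw [e]
  linarith

/-! ### Cutoff -/

theorem tendsto_root4 : Tendsto root4 atTop atTop :=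
  Real.tendsto_sqrt_atTop.comp (Real.tendsto_sqrt_atTop.comp tendsto_natCast_atTop_atTop)

theorem root4_estimates {n : ℕ} (hn : 10000 ≤ n) : √(n : ℝ) = root4 n ^ 2 ∧
    Real.log n ≤ 4 * root4 n ∧ root4 n ^ 6 = Real.exp (3 / 2 * Real.log n) ∧ 1 ≤ Real.log n := by
  obtain ⟨hq, hqn⟩ := root4_facts hn
  have hn' : (10000 : ℝ) ≤ n := by exact_mod_cast hn
  have hlog : Real.log n = 4 * Real.log (root4 n) := by
    rw [← hqn, Real.log_pow]; push_cast; ring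
  have hq0 : 0 < root4 n := by linarith
  refine ⟨(Real.sq_sqrt (Real.sqrt_nonneg _)).symm, ?_, ?_, ?_⟩
  · have := Real.log_le_sub_one_of_pos hq0
    linarith
  · rw [hlog, show 3 / 2 * (4 * Real.log (root4 n)) = (6 : ℕ) * Real.log (root4 n) by
      push_cast; ring, Real.exp_nat_mul, Real.exp_log hq0]
  · rw [Real.le_log_iff_exp_le (by linarith)]
    have := Real.exp_one_lt_d9
    linarith

theorem pow_le_exp_of_le {a c : ℝ} (ha : a ≤ 1) {m : ℕ} (h : c ≤ a * m) :
    (1 - a) ^ m ≤ Real.exp (-c) := by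
  calc (1 - a) ^ m ≤ Real.exp (-a) ^ m := by
        have := Real.one_sub_le_exp_neg a
        gcongr
    _ = Real.exp (-(a * m)) := by rw [← Real.exp_nat_mul]; ring_nf
    _ ≤ _ := by gcongr

/-- Upper bound at time `3 / 2 n log n + α n`: `α n / 2` steps are spent leaving the weight `1`,
`n` steps on smoothing, and the remaining ones on contracting gradients by a factor of order
`n ^ (-3 / 2) * exp (-α / 2)`. -/
theorem eventually_weightDist_le {α : ℝ} (hα : 0 ≤ α) :
    ∀ᶠ n : ℕ in atTop, weightDist n ⌊3 / 2 * (n : ℝ) * Real.log n + α * n⌋₊ ≤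
      200000 * Real.exp (-(α / 2)) := by
  have hpi : Tendsto (fun n : ℕ => 4 * ((n : ℝ) ^ 3 / 2 ^ n)) atTop (𝓝 0) := by
    have := (tendsto_pow_const_div_const_pow_of_one_lt 3 (one_lt_two : (1 : ℝ) < 2)).const_mul 4
    simpa using this
  have hroot : Tendsto (fun n : ℕ => 320002 / root4 n) atTop (𝓝 0) :=
    tendsto_root4.const_div_atTop _
  have hpos : 0 < Real.exp (-(α / 2)) := Real.exp_pos _
  filter_upwards [eventually_ge_atTop 10000, tendsto_root4.eventually_ge_atTop (60 + α),
    hpi.eventually_lt_const hpos, hroot.eventually_lt_const hpos] with n hn hqα h1 h2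
  obtain ⟨hq, hqn⟩ := root4_facts hn
  obtain ⟨hsq, hlogq, hq6, hlog1⟩ := root4_estimates hn
  have hn' : (10000 : ℝ) ≤ n := by exact_mod_cast hn
  have hn0 : (0 : ℝ) < n := by linarith
  set q := root4 n with hqdef
  set l := Real.log n with hl
  obtain ⟨T, hT⟩ : ∃ T : ℕ, T = ⌊3 / 2 * (n : ℝ) * l + α * n⌋₊ := ⟨_, rfl⟩
  obtain ⟨i, hi⟩ : ∃ i : ℕ, i = ⌊α / 2 * n⌋₊ := ⟨_, rfl⟩
  have hT1 : 3 / 2 * (n : ℝ) * l + α * n - 1 ≤ T := by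
    rw [hT]; exact (Nat.sub_one_lt_floor _).le
  have hi1 : α / 2 * n - 1 ≤ i := by rw [hi]; exact (Nat.sub_one_lt_floor _).le
  have hi2 : (i : ℝ) ≤ α / 2 * n := by rw [hi]; exact Nat.floor_le (by positivity)
  have hTi : i + n ≤ T := by
    have : (i : ℝ) + n ≤ T := by nlinarith
    exact_mod_cast this
  obtain ⟨m, rfl⟩ : ∃ m, T = i + (m + n) := ⟨T - (i + n), by omega⟩
  rw [← hT]
  push_cast at hT1
  have hm : (n : ℝ) * (3 / 2 * l + α / 2 - 1 - 1 / n) ≤ m := by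
    have : (n : ℝ) * (3 / 2 * l + α / 2 - 1 - 1 / n) = 3 / 2 * n * l + α / 2 * n - n - 1 := by
      field_simp
    linarith
  have hinv : 1 / (n : ℝ) ≤ 1 / 10000 := one_div_le_one_div_of_le (by norm_num) hn'
  have hcm : 3 / 2 * l + α / 2 - 3 ≤ contr n * m := by
    obtain ⟨c0, -⟩ := contr_mem (by omega : 100 ≤ n)
    have h3 := mul_le_mul_of_nonneg_left hm c0.le
    have h4 : contr n * ((n : ℝ) * (3 / 2 * l + α / 2 - 1 - 1 / n)) =
        (1 - 5 / q ^ 2) * (3 / 2 * l + α / 2 - 1 - 1 / n) := by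
      rw [contr, hsq]; field_simp
    have h5 : 5 / q ^ 2 * (3 / 2 * l + α / 2) ≤ 1 := by
      rw [div_mul_eq_mul_div, div_le_one (by positivity)]
      nlinarith
    have h6 : 0 ≤ 5 / q ^ 2 := by positivity
    have h7 : 0 ≤ 1 / (n : ℝ) := by positivity
    nlinarith
  have hc1 : contr n ≤ 1 := by
    obtain ⟨-, c1⟩ := contr_mem (by omega : 100 ≤ n)
    linarith
  have hA := pow_le_exp_of_le hc1 hcm
  have hB : (1 - 1 / (n : ℝ)) ^ i ≤ Real.exp (-(α / 2 - 1)) := by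
    apply pow_le_exp_of_le (by linarith)
    rw [one_div, inv_mul_eq_div, le_div_iff₀ hn0]
    linarith
  refine (weightDist_le hn i m).trans ?_
  rw [mixBound, ← hqdef]
  have e1 : 8004 * q ^ 6 * (1 - contr n) ^ m ≤ 8004 * Real.exp 1 ^ 3 * Real.exp (-(α / 2)) := by
    calc _ ≤ 8004 * q ^ 6 * Real.exp (-(3 / 2 * l + α / 2 - 3)) := by gcongr
      _ = 8004 * (Real.exp (3 / 2 * l) * Real.exp (-(3 / 2 * l + α / 2 - 3))) := by
        rw [hq6]; ring
      _ = _ := by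
        rw [← Real.exp_add, ← Real.exp_nat_mul, mul_assoc, ← Real.exp_add]
        congr 2; push_cast; ring
  have e2 : Real.exp (-(α / 2 - 1)) = Real.exp 1 * Real.exp (-(α / 2)) := by
    rw [← Real.exp_add]; congr 1; ring
  have e3 : (n : ℝ) / (2 ^ n - 1) * (1 + q ^ 5) ≤ Real.exp (-(α / 2)) := by
    refine le_trans ?_ h1.le
    have h2n : (2 : ℝ) ^ n / 2 ≤ 2 ^ n - 1 := by
      have : (2 : ℝ) ≤ 2 ^ n := le_self_pow₀ (by norm_num) (by omega)
      linarith
    have hq5 : 1 + q ^ 5 ≤ 2 * (n : ℝ) ^ 2 := by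
      have a1 : 1 ≤ q ^ 8 := one_le_pow₀ (by linarith)
      have a2 : q ^ 5 ≤ q ^ 8 := pow_le_pow_right₀ (by linarith) (by norm_num)
      rw [← hqn, show (q ^ 4) ^ 2 = q ^ 8 by ring]
      linarith
    calc _ ≤ (n : ℝ) / (2 ^ n / 2) * (2 * (n : ℝ) ^ 2) := by gcongr
      _ = _ := by field_simp; norm_num
  have hexp : Real.exp 1 ≤ 2.72 := by have := Real.exp_one_lt_d9; linarith
  have hexp3 : Real.exp 1 ^ 3 ≤ 21 := by
    calc Real.exp 1 ^ 3 ≤ 2.72 ^ 3 := by gcongr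
      _ ≤ 21 := by norm_num
  have b1 : 8004 * Real.exp 1 ^ 3 * Real.exp (-(α / 2)) ≤
      8004 * 21 * Real.exp (-(α / 2)) := by gcongr
  have b2 : Real.exp 1 * Real.exp (-(α / 2)) ≤ 2.72 * Real.exp (-(α / 2)) := by gcongr
  rw [e2] at hB
  linarith

theorem le_one_sub_relax_pow {n : ℕ} (hn : 100 ≤ n) {t : ℕ} {c : ℝ}
    (h : (1 + 5 / (n : ℝ)) / n * t ≤ c) : Real.exp (-c) ≤ (1 - relax n) ^ t := by
  have hn2 : 2 ≤ n := by omega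
  have hn' : (100 : ℝ) ≤ n := by exact_mod_cast hn
  have hr := relax_pos hn2
  have hr1 : relax n ≤ 1 / 2 := by
    rw [relax, div_le_div_iff₀ (by nlinarith) (by norm_num)]; nlinarith
  have h1 : 0 < 1 - relax n := by linarith
  have hle : relax n / (1 - relax n) ≤ (1 + 5 / (n : ℝ)) / n := by
    rw [div_le_iff₀ h1, relax]
    have hn1 : (0 : ℝ) < n - 1 := by linarith
    rw [← sub_nonneg]
    have : (1 + 5 / (n : ℝ)) / n * (1 - (n + 1) / (n * (n - 1))) - (n + 1) / (n * (n - 1)) =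
        (2 * n ^ 2 - 11 * n - 5) / (n ^ 3 * (n - 1)) := by field_simp; ring
    rw [this]
    apply div_nonneg _ (by positivity)
    nlinarith
  have h2 : Real.exp (-(relax n / (1 - relax n))) ≤ 1 - relax n := by
    rw [Real.exp_neg]
    apply inv_le_of_inv_le₀ h1
    have h3 := Real.add_one_le_exp (relax n / (1 - relax n))
    have : (1 - relax n)⁻¹ = relax n / (1 - relax n) + 1 := by field_simp; ring
    rw [this]; exact h3
  calc Real.exp (-c) ≤ Real.exp (-(relax n / (1 - relax n) * t)) := by
        gcongr
        exact le_trans (by gcongr) h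
    _ = Real.exp (-(relax n / (1 - relax n))) ^ t := by rw [← Real.exp_nat_mul]; ring_nf
    _ ≤ _ := by gcongr

/-- The last error term of `one_sub_le_weightDist` for `δ = 1 / E ^ 2`. -/
theorem chebyshev_error_le {E D c : ℝ} (hE1 : 1 ≤ E) (hc : 0 < c) (hc1 : c ≤ 2.72)
    (hD : 36 * E ^ 8 / c ^ 2 ≤ D) :
    (2560000 + 80 / (E ^ 2)⁻¹ ^ 3) / D ≤ 570000 * E⁻¹ := by
  have hE0 : 0 < E := by linarith
  have e1 : 80 / (E ^ 2)⁻¹ ^ 3 = 80 * E ^ 6 := by field_simp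
  have e2 : 2560000 ≤ 2560000 * E ^ 6 := le_mul_of_one_le_right (by norm_num) (one_le_pow₀ hE1)
  have e3 : c ^ 2 ≤ 7.4 := by nlinarith
  calc _ ≤ (2560000 * E ^ 6 + 80 * E ^ 6) / (36 * E ^ 8 / c ^ 2) := by
        rw [e1]; gcongr
    _ = 2560080 / 36 * c ^ 2 * (E⁻¹ * E⁻¹) := by field_simp; norm_num
    _ ≤ 2560080 / 36 * 7.4 * (1 * E⁻¹) := by
        gcongr
        exact inv_le_one_of_one_le₀ hE1
    _ ≤ _ := by
        rw [one_mul]; gcongr; norm_num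

set_option maxHeartbeats 1000000 in
/-- Lower bound at time `3 / 2 n log n - 5 β n`: the first stage lasts `n log n - β n` steps and
leaves the weight above `exp (-2 β) n`, up to an error of order `exp (-β)`; the second stage lasts
`1 / 2 n log n - 4 β n` steps and leaves `recip` of order `n ^ (-3 / 2) * exp (4 β)`, which
dominates its standard deviation, of order `n ^ (-3 / 2) * exp (3 β)`. -/
theorem eventually_le_weightDist {β : ℝ} (hβ : 0 ≤ β) :
    ∀ᶠ n : ℕ in atTop, 1 - 600000 * Real.exp (-β) ≤
      weightDist n ⌊3 / 2 * (n : ℝ) * Real.log n - 5 * β * n⌋₊ := by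
  have hlog : Tendsto (fun n : ℕ => Real.log n) atTop atTop :=
    Real.tendsto_log_atTop.comp tendsto_natCast_atTop_atTop
  filter_upwards [eventually_ge_atTop 10000, tendsto_root4.eventually_ge_atTop 60,
    hlog.eventually_ge_atTop (8 * β + 2)] with n hn hq60 hlβ
  obtain ⟨hq, hqn⟩ := root4_facts hn
  obtain ⟨hsq, hlogq, -, hlog1⟩ := root4_estimates hn
  have hn' : (10000 : ℝ) ≤ n := by exact_mod_cast hn
  have hn0 : (0 : ℝ) < n := by linarith
  set q := root4 n with hqdef
  set l := Real.log n with hl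
  have hexpl : Real.exp l = n := Real.exp_log hn0
  obtain ⟨T, hT⟩ : ∃ T : ℕ, T = ⌊3 / 2 * (n : ℝ) * l - 5 * β * n⌋₊ := ⟨_, rfl⟩
  obtain ⟨s, hs⟩ : ∃ s : ℕ, s = ⌊(n : ℝ) * l - β * n⌋₊ := ⟨_, rfl⟩
  have hT1 : 3 / 2 * (n : ℝ) * l - 5 * β * n - 1 ≤ T := by
    rw [hT]; exact (Nat.sub_one_lt_floor _).le
  have hT2 : (T : ℝ) ≤ 3 / 2 * (n : ℝ) * l - 5 * β * n := by
    rw [hT]; apply Nat.floor_le; nlinarith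
  have hs1 : (n : ℝ) * l - β * n - 1 ≤ s := by rw [hs]; exact (Nat.sub_one_lt_floor _).le
  have hs2 : (s : ℝ) ≤ (n : ℝ) * l - β * n := by
    rw [hs]; apply Nat.floor_le; nlinarith
  have hTs : s ≤ T := by
    have : (s : ℝ) ≤ T := by nlinarith
    exact_mod_cast this
  obtain ⟨t, rfl⟩ : ∃ t, T = s + t := ⟨T - s, by omega⟩
  rw [← hT]
  push_cast at hT2
  have ht : (t : ℝ) ≤ n * (1 / 2 * l - 4 * β + 1 / n) := by
    have : (n : ℝ) * (1 / 2 * l - 4 * β + 1 / n) = 1 / 2 * n * l - 4 * β * n + 1 := by field_simp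
    linarith
  have hinv : 1 / (n : ℝ) ≤ 1 / 10000 := one_div_le_one_div_of_le (by norm_num) hn'
  have hinv0 : 0 < 1 / (n : ℝ) := by positivity
  -- the growth during the first stage
  have g1 : (1 + 1 / (n : ℝ)) ^ s ≤ n * Real.exp (-β) := by
    calc (1 + 1 / (n : ℝ)) ^ s ≤ Real.exp (1 / n) ^ s := by
          gcongr
          have := Real.add_one_le_exp (1 / (n : ℝ))
          linarith
      _ = Real.exp (s / n) := by rw [← Real.exp_nat_mul]; congr 1; ring
      _ ≤ Real.exp (l + -β) := by
          gcongr
          rw [div_le_iff₀ hn0]; linarith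
      _ = _ := by rw [Real.exp_add, hexpl]
  have g2 : (1 - contr n) ^ s ≤ Real.exp 1 * Real.exp β / n := by
    obtain ⟨c0, c1⟩ := contr_mem (by omega : 100 ≤ n)
    have hs' : (n : ℝ) * (l - β - 1 / n) ≤ s := by
      have : (n : ℝ) * (l - β - 1 / n) = n * l - β * n - 1 := by field_simp
      linarith
    have h3 := mul_le_mul_of_nonneg_left hs' c0.le
    have h4 : contr n * ((n : ℝ) * (l - β - 1 / n)) = (1 - 5 / q ^ 2) * (l - β - 1 / n) := by
      rw [contr, hsq]; field_simp
    have h5 : 5 / q ^ 2 * l ≤ 1 / 2 := by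
      rw [div_mul_eq_mul_div, div_le_iff₀ (by positivity)]
      nlinarith
    have h6 : 0 ≤ 5 / q ^ 2 := by positivity
    have h7 : l - β - 1 ≤ contr n * s := by
      have : 0 ≤ 5 / q ^ 2 * (β + 1 / n) := by positivity
      nlinarith
    refine (pow_le_exp_of_le (by linarith) h7).trans (le_of_eq ?_)
    rw [eq_div_iff hn0.ne', ← hexpl, ← Real.exp_add, ← Real.exp_add]
    congr 1; ring
  have g3 : Real.exp (-(1 / 2 * l - 4 * β + 1)) ≤ (1 - relax n) ^ t := by
    apply le_one_sub_relax_pow (by omega)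
    have h5 : 5 / (n : ℝ) * (1 / 2 * l + 1 / n) ≤ 1 / 2 := by
      have hq4 : 60 * q ≤ n := by
        rw [← hqn]
        have : (1 : ℝ) ≤ q ^ 2 := one_le_pow₀ (by linarith)
        nlinarith [mul_pos (by linarith : 0 < q) (by linarith : 0 < q)]
      rw [div_mul_eq_mul_div, div_le_iff₀ hn0]
      linarith
    have h6 : 0 ≤ 5 / (n : ℝ) * β := by positivity
    calc (1 + 5 / (n : ℝ)) / n * t ≤ (1 + 5 / (n : ℝ)) / n * (n * (1 / 2 * l - 4 * β + 1 / n)) := by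
          gcongr
      _ = (1 + 5 / (n : ℝ)) * (1 / 2 * l - 4 * β + 1 / n) := by field_simp
      _ ≤ _ := by nlinarith
  set E := Real.exp β with hE
  have hE1 : 1 ≤ E := Real.one_le_exp hβ
  have hEneg : Real.exp (-β) = E⁻¹ := Real.exp_neg β
  have hexp : Real.exp 1 ≤ 2.72 := by have := Real.exp_one_lt_d9; linarith
  have g4 : 36 * E ^ 8 / Real.exp 1 ^ 2 ≤
      (n : ℝ) ^ 3 * (6 / n * (1 - relax n) ^ t) ^ 2 := by
    have : Real.exp (-(1 / 2 * l - 4 * β + 1)) ^ 2 = E ^ 8 / (Real.exp 1 ^ 2 * n) := by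
      rw [eq_div_iff (by positivity), ← hexpl, hE, ← Real.exp_nat_mul, ← Real.exp_nat_mul,
        ← Real.exp_nat_mul, ← Real.exp_add, ← Real.exp_add]
      congr 1; push_cast; ring
    calc 36 * E ^ 8 / Real.exp 1 ^ 2 =
        36 * n * Real.exp (-(1 / 2 * l - 4 * β + 1)) ^ 2 := by rw [this]; field_simp
      _ ≤ 36 * n * ((1 - relax n) ^ t) ^ 2 := by gcongr
      _ = _ := by field_simp; ring
  have hδ : 0 < (E ^ 2)⁻¹ := by positivity
  refine le_trans ?_ (one_sub_le_weightDist (by omega) s t hδ)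
  apply sub_le_sub_left
  have t1 : 16 * (1 + 1 / (n : ℝ)) ^ s / n ≤ 16 * E⁻¹ := by
    rw [div_le_iff₀ hn0, ← hEneg]; linarith
  have t2 : (E ^ 2)⁻¹ * n * ((1 - contr n) ^ s + 5 / n) ≤ 8 * E⁻¹ := by
    calc _ ≤ (E ^ 2)⁻¹ * n * (Real.exp 1 * E / n + 5 / n) := by gcongr
      _ = (E ^ 2)⁻¹ * (Real.exp 1 * E + 5) := by field_simp
      _ ≤ (E ^ 2)⁻¹ * (2.72 * E + 5 * E) := by gcongr; linarith
      _ = 7.72 * E⁻¹ := by field_simp; norm_num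
      _ ≤ _ := by gcongr; norm_num
  have t3 : (2560000 + 80 / (E ^ 2)⁻¹ ^ 3) /
      ((n : ℝ) ^ 3 * (6 / n * (1 - relax n) ^ t) ^ 2) ≤ 570000 * E⁻¹ :=
    chebyshev_error_le hE1 (Real.exp_pos 1) hexp g4
  rw [hEneg]
  have : 0 < E⁻¹ := by positivity
  linarith

theorem hasCutoff_weightDist : HasCutoff weightDist
    (fun n => 3 / 2 * (n : ℝ) * Real.log (n : ℝ)) (fun n => (n : ℝ)) := by
  have hlow : ∀ T : ℕ → ℕ, ∀ᶠ n in atTop, 0 ≤ weightDist n (T n) := fun T =>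
    (eventually_ge_atTop 2).mono fun n hn => weightDist_nonneg hn _
  have hhigh : ∀ T : ℕ → ℕ, ∀ᶠ n in atTop, weightDist n (T n) ≤ 1 := fun T =>
    (eventually_ge_atTop 2).mono fun n hn => weightDist_le_one hn _
  have hbb : ∀ T : ℕ → ℕ, IsBoundedUnder (· ≥ ·) atTop fun n => weightDist n (T n) :=
    fun T => ⟨0, hlow T⟩
  have hba : ∀ T : ℕ → ℕ, IsBoundedUnder (· ≤ ·) atTop fun n => weightDist n (T n) :=
    fun T => ⟨1, hhigh T⟩
  have hexp : ∀ c : ℝ, 0 < c → Tendsto (fun α : ℝ => Real.exp (-(c * α))) atTop (𝓝 0) :=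
    fun c hc => Real.tendsto_exp_neg_atTop_nhds_zero.comp (tendsto_id.const_mul_atTop hc)
  constructor
  · have h1 : Tendsto (fun α : ℝ => 1 - 600000 * Real.exp (-(1 / 5 * α))) atTop (𝓝 1) := by
      simpa using ((hexp (1 / 5) (by norm_num)).const_mul 600000).const_sub 1
    refine tendsto_of_tendsto_of_tendsto_of_le_of_le' h1 tendsto_const_nhds ?_ ?_
    · filter_upwards [eventually_ge_atTop 0] with α hα
      have h := eventually_le_weightDist (β := 1 / 5 * α) (by positivity)
      rw [show 5 * (1 / 5 * α) = α by ring] at h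
      exact le_liminf_of_le (hba _).isCoboundedUnder_ge h
    · exact Eventually.of_forall fun α =>
        (liminf_le_limsup (hba _) (hbb _)).trans
          (limsup_le_of_le (hbb _).isCoboundedUnder_le (hhigh _))
  · have h1 : Tendsto (fun α : ℝ => 200000 * Real.exp (-(1 / 2 * α))) atTop (𝓝 0) := by
      simpa using (hexp (1 / 2) (by norm_num)).const_mul 200000
    refine tendsto_of_tendsto_of_tendsto_of_le_of_le' tendsto_const_nhds h1 ?_ ?_
    · exact Eventually.of_forall fun α =>
        (le_liminf_of_le (hba _).isCoboundedUnder_ge (hlow _)).trans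
          (liminf_le_limsup (hba _) (hbb _))
    · filter_upwards [eventually_ge_atTop 0] with α hα
      have h := eventually_weightDist_le hα
      rw [show α / 2 = 1 / 2 * α by ring] at h
      exact limsup_le_of_le (hbb _).isCoboundedUnder_le h

end HammingWalk

theorem proposition2 :
    (∀ n : ℕ, 2 ≤ n →
      -- the law of the next weight depends on the current vector only through its weight
      (∀ (x : HammingWalk.Cube n) (l : HammingWalk.Weight n),
        HammingWalk.stepToWeight n x l = HammingWalk.weightP n (HammingWalk.weight x) l) ∧
      -- the Hamming weight of the walk is a Markov chain, for every initial law of the walk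
      (∀ (Ω : Type*) [MeasurableSpace Ω] (μ : Measure Ω) [IsProbabilityMeasure μ]
        (Z : ℕ → Ω → HammingWalk.Cube n),
        HammingWalk.IsMarkovChain μ Z (HammingWalk.walkP n) →
        HammingWalk.IsMarkovChain μ (fun t ω => HammingWalk.weight (Z t ω))
          (HammingWalk.weightP n)) ∧
      -- it is a birth-and-death chain with explicit rates
      (∀ k l : HammingWalk.Weight n, l.1 = k.1 + 1 → HammingWalk.weightP n k l =
        (k.1 : ℝ) * ((n : ℝ) - (k.1 : ℝ)) / ((n : ℝ) * ((n : ℝ) - 1))) ∧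
      (∀ k l : HammingWalk.Weight n, l.1 + 1 = k.1 → HammingWalk.weightP n k l =
        (k.1 : ℝ) * ((k.1 : ℝ) - 1) / ((n : ℝ) * ((n : ℝ) - 1))) ∧
      (∀ k : HammingWalk.Weight n, HammingWalk.weightP n k k =
        ((n : ℝ) - (k.1 : ℝ)) / (n : ℝ)) ∧
      (∀ k l : HammingWalk.Weight n, k.1 + 1 < l.1 ∨ l.1 + 1 < k.1 →
        HammingWalk.weightP n k l = 0) ∧
      -- its unique stationary law
      (∀ ν : HammingWalk.Weight n → ℝ,
        HammingWalk.IsStationaryLaw (HammingWalk.weightP n) ν ↔ ν = HammingWalk.weightPi n)) ∧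
    -- cutoff
    HammingWalk.HasCutoff HammingWalk.weightDist
      (fun n => 3 / 2 * (n : ℝ) * Real.log (n : ℝ)) (fun n => (n : ℝ)) := by
  refine ⟨fun n hn => ?_, HammingWalk.hasCutoff_weightDist⟩
  have hlump : ∀ (x : HammingWalk.Cube n) (l : HammingWalk.Weight n),
      HammingWalk.stepToWeight n x l = HammingWalk.weightP n (HammingWalk.weight x) l :=
    fun x l => by rw [HammingWalk.stepToWeight_eq_rate hn, HammingWalk.weightP_eq_rate hn]
  refine ⟨hlump, fun Ω _ μ _ Z hZ => hZ.lump HammingWalk.weight _ hlump, ?_, ?_, ?_, ?_, ?_⟩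
  · intro k l h
    rw [HammingWalk.weightP_eq_rate hn, HammingWalk.rate, if_pos h, if_neg (by omega),
      if_neg (by omega), HammingWalk.up]
    ring
  · intro k l h
    rw [HammingWalk.weightP_eq_rate hn, HammingWalk.rate, if_neg (by omega), if_pos h,
      if_neg (by omega), HammingWalk.down]
    ring
  · intro k
    have hn0 : (n : ℝ) ≠ 0 := by exact_mod_cast (by omega : n ≠ 0)
    rw [HammingWalk.weightP_eq_rate hn, HammingWalk.rate, if_neg (by omega), if_neg (by omega),
      if_pos rfl, sub_div, div_self hn0]
    ring
  · intro k l h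
    rw [HammingWalk.weightP_eq_rate hn, HammingWalk.rate, if_neg (by omega), if_neg (by omega),
      if_neg (by omega)]
    ring
  · intro ν
    exact ⟨fun h => h.eq_weightPi hn, fun h => h ▸ HammingWalk.isStationaryLaw_weightPi hn⟩
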